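/- Let $k\ge 1$ be an integer, let $T>0$ and let $q$ be a real number such that $$\left(\frac{(k-1)\pi}{T}\right)^2+2<q\le\left(\frac{k\pi}{T}\right)^2+2 .$$ Consider the positive solutions $y\in C^2(\mathbb R)$ of $-y''+y=y^{q-1}$ on $\mathbb R$ that have $2T$ as a (not necessarily minimal) period, and call two of them equivalent if one is obtained from the other by a translation $x\mapsto x+c$, $c\in\mathbb R$. Then there are exactly $k$ equivalence classes. More precisely: $y\equiv 1$ is such a solution; for every integer $n$ with $1\le n\le k-1$ there is a non-constant such solution with minimal positive period $2T/n$, and it is unique up to translation; and every such solution is either $y\equiv 1$ or has minimal positive period $2T/n$ for some integer $1\le n\le k-1$. -/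

import Mathlib

/-- `y` is a positive classical solution on the whole line of `-y'' + y = y ^ (q - 1)`
having `2T` as a period (not necessarily the smallest one). -/
structure IsPosPeriodicSolution (q T : ℝ) (y : ℝ → ℝ) : Prop where
  contDiff : ContDiff ℝ 2 y
  pos : ∀ x, 0 < y x
  periodic : Function.Periodic y (2 * T)
  equation : ∀ x, -deriv (deriv y) x + y x = (y x) ^ (q - 1)

/-- `z` is obtained from `y` by a translation of the independent variable. -/
def IsTranslate (y z : ℝ → ℝ) : Prop :=
  ∃ c : ℝ, ∀ x, z x = y (x + c)

/-- `p` is the smallest positive period of `y`. -/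
def HasMinimalPeriod (y : ℝ → ℝ) (p : ℝ) : Prop :=
  IsLeast {s : ℝ | 0 < s ∧ Function.Periodic y s} p

/-- Equivalence up to translation, on the set of positive `2T`-periodic solutions. -/
def translateSetoid (q T : ℝ) : Setoid {y : ℝ → ℝ // IsPosPeriodicSolution q T y} where
  r y z := IsTranslate y.1 z.1
  iseqv :=
    { refl := fun _ => ⟨0, fun x => by rw [add_zero]⟩
      symm := fun {_ _} ⟨c, h⟩ => ⟨-c, fun x => by rw [h, neg_add_cancel_right]⟩
      trans := fun {_ _ _} ⟨c, h⟩ ⟨d, k⟩ => ⟨d + c, fun x => by rw [k, h, add_assoc]⟩ }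

open Filter Topology Set

/-! With p = q - 2 the equation reads y'' = -V'(y), where V'(y) = y^(p+1) - y and V ≥ 0 vanishes on
[0, ∞) only at y = 1. The non-constant positive periodic solutions are the closed orbits around the
equilibrium 1, of energy r² with 0 < r < ρ and ρ² = V(0); up to translation there is one for each r
(`eq_orbit`), and its minimal period is P(r). Here P is continuous, strictly increasing, equal to
2π/√p at r = 0 and unbounded as r varies below ρ. Hence 2T/n is a minimal period exactly when n <
T√p/π, and then for a single r; the hypothesis on q says that k - 1 < T√p/π ≤ k.

The core is the monotonicity of P, by a convexity criterion of Chicone. Let g be the inverse of h =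
sign(y - 1)√V. Writing y = g(r sin θ), y' = √2 r cos θ turns P(r) into the integral of g'(r sin
θ)/√2 over a full turn. Pairing θ with θ + π, it suffices that g'(s) + g'(-s) increases for s > 0.
Since g' = 2√Φ(g) with Φ = V/V'², one finds g'' = 2Φ'(g), so the claim becomes Φ'(g(-s)) < Φ'(g(s)),
which follows from strict convexity of Φ (`chicone_pos`, `wellPhi'_lt`, `strictMonoOn_orbitPeriod`).
Unboundedness of P comes from the slow passage near y = 0 (`le_wellG'_neg`, `log_le_orbitPeriod`).
-/

/-- A continuous function whose derivative near `a` extends continuously to `a` is differentiable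
at `a`. -/
lemma hasDerivAt_of_eventually_hasDerivAt {f f' : ℝ → ℝ} {a : ℝ}
    (h : ∀ᶠ y in 𝓝[≠] a, HasDerivAt f (f' y) y) (hf : ContinuousAt f a)
    (hf' : ContinuousAt f' a) : HasDerivAt f (f' a) a := by
  rw [hasDerivAt_iff_tendsto_slope]
  have key : Tendsto (fun x => (f x - f a) / (x - a)) (𝓝[≠] a) (𝓝 (f' a)) := by
    refine HasDerivAt.lhopital_zero_nhdsNE (f' := f') (g' := fun _ => 1) ?_ ?_ ?_ ?_ ?_ ?_
    · exact h.mono fun y hy => hy.sub_const _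
    · exact Eventually.of_forall fun y => (hasDerivAt_id y).sub_const a
    · simp
    · have := hf.tendsto.sub_const (f a)
      rw [sub_self] at this
      exact this.mono_left nhdsWithin_le_nhds
    · have : Tendsto (fun x : ℝ => x - a) (𝓝 a) (𝓝 (a - a)) := tendsto_id.sub_const a
      rw [sub_self] at this
      exact this.mono_left nhdsWithin_le_nhds
    · simpa using hf'.tendsto.mono_left nhdsWithin_le_nhds
  refine key.congr fun x => ?_
  rw [slope_def_field]

/-! ### The potential V and the strict convexity of V / V'². -/

/-- The potential of `y'' = y - y ^ (p + 1)`, normalised to vanish at its minimum `y = 1`. -/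
noncomputable def wellV (p y : ℝ) : ℝ := y ^ 2 * (y ^ p / (p + 2) - 1 / 2) + p / (2 * (p + 2))

/-- First derivative of `wellV`. -/
noncomputable def wellV' (p y : ℝ) : ℝ := y * (y ^ p - 1)

/-- Second derivative of `wellV`. -/
noncomputable def wellV'' (p y : ℝ) : ℝ := (p + 1) * y ^ p - 1

/-- Third derivative of `wellV`. -/
noncomputable def wellV''' (p y : ℝ) : ℝ := p * (p + 1) * y ^ p / y

section Well

variable {p : ℝ}

lemma hasDerivAt_rpow_div (p : ℝ) {y : ℝ} (hy : 0 < y) :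
    HasDerivAt (fun y : ℝ => y ^ p) (p * y ^ p / y) y := by
  have := Real.hasDerivAt_rpow_const (x := y) (p := p) (Or.inl hy.ne')
  rwa [Real.rpow_sub_one hy.ne', ← mul_div_assoc] at this

lemma hasDerivAt_wellV (hp : 0 < p) {y : ℝ} (hy : 0 < y) :
    HasDerivAt (wellV p) (wellV' p y) y := by
  have h := (((hasDerivAt_pow 2 y).mul (((hasDerivAt_rpow_div p hy).div_const (p + 2)).sub_const
    (1 / 2))).add_const (p / (2 * (p + 2))))
  refine h.congr_deriv ?_
  unfold wellV'
  have : p + 2 ≠ 0 := by positivity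
  field_simp
  ring

lemma hasDerivAt_wellV' {y : ℝ} (hy : 0 < y) :
    HasDerivAt (wellV' p) (wellV'' p y) y := by
  have h := (hasDerivAt_id y).mul ((hasDerivAt_rpow_div p hy).sub_const 1)
  refine h.congr_deriv ?_
  unfold wellV''
  simp only [id]
  field_simp
  ring

lemma hasDerivAt_wellV'' {y : ℝ} (hy : 0 < y) :
    HasDerivAt (wellV'' p) (wellV''' p y) y := by
  have h := ((hasDerivAt_rpow_div p hy).const_mul (p + 1)).sub_const 1
  refine h.congr_deriv ?_
  unfold wellV'''
  ring

@[simp] lemma wellV_one (hp : 0 < p) : wellV p 1 = 0 := by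
  unfold wellV
  have : p + 2 ≠ 0 := by positivity
  rw [Real.one_rpow]
  field_simp
  ring

@[simp] lemma wellV'_one : wellV' p 1 = 0 := by simp [wellV']

@[simp] lemma wellV''_one : wellV'' p 1 = p := by simp [wellV'']

@[simp] lemma wellV'''_one : wellV''' p 1 = p * (p + 1) := by simp [wellV''']

lemma wellV_zero : wellV p 0 = p / (2 * (p + 2)) := by simp [wellV]

lemma continuous_wellV (hp : 0 < p) : Continuous (wellV p) := by
  unfold wellV
  have : Continuous fun y : ℝ => y ^ p := Real.continuous_rpow_const hp.le
  fun_prop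

lemma rpow_sub_one_pos (hp : 0 < p) {y : ℝ} (hy : 1 < y) : 0 < y ^ p - 1 :=
  sub_pos.2 (Real.one_lt_rpow hy hp)

lemma rpow_sub_one_neg (hp : 0 < p) {y : ℝ} (hy : 0 < y) (hy1 : y < 1) : y ^ p - 1 < 0 :=
  sub_neg.2 (Real.rpow_lt_one hy.le hy1 hp)

lemma wellV'_pos (hp : 0 < p) {y : ℝ} (hy : 1 < y) : 0 < wellV' p y :=
  mul_pos (one_pos.trans hy) (rpow_sub_one_pos hp hy)

lemma wellV'_neg (hp : 0 < p) {y : ℝ} (hy : 0 < y) (hy1 : y < 1) : wellV' p y < 0 :=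
  mul_neg_of_pos_of_neg hy (rpow_sub_one_neg hp hy hy1)

lemma wellV'_ne_zero (hp : 0 < p) {y : ℝ} (hy : 0 < y) (hy1 : y ≠ 1) : wellV' p y ≠ 0 := by
  rcases lt_or_gt_of_ne hy1 with h | h
  · exact (wellV'_neg hp hy h).ne
  · exact (wellV'_pos hp h).ne'

lemma strictMonoOn_wellV (hp : 0 < p) : StrictMonoOn (wellV p) (Ici 1) := by
  refine strictMonoOn_of_deriv_pos (convex_Ici 1) (continuous_wellV hp).continuousOn ?_
  intro y hy
  rw [interior_Ici] at hy
  rw [(hasDerivAt_wellV hp (one_pos.trans hy)).deriv]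
  exact wellV'_pos hp hy

lemma strictAntiOn_wellV (hp : 0 < p) : StrictAntiOn (wellV p) (Icc 0 1) := by
  refine strictAntiOn_of_deriv_neg (convex_Icc 0 1) (continuous_wellV hp).continuousOn ?_
  intro y hy
  rw [interior_Icc] at hy
  rw [(hasDerivAt_wellV hp hy.1).deriv]
  exact wellV'_neg hp hy.1 hy.2

lemma wellV_pos (hp : 0 < p) {y : ℝ} (hy : 0 ≤ y) (hy1 : y ≠ 1) : 0 < wellV p y := by
  rw [← wellV_one hp]
  rcases lt_or_gt_of_ne hy1 with h | h
  · exact strictAntiOn_wellV hp ⟨hy, h.le⟩ ⟨zero_le_one, le_rfl⟩ h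
  · exact strictMonoOn_wellV hp (mem_Ici.2 le_rfl) (mem_Ici.2 h.le) h

lemma wellV_nonneg (hp : 0 < p) {y : ℝ} (hy : 0 ≤ y) : 0 ≤ wellV p y := by
  by_cases h : y = 1
  · simp [h, hp]
  · exact (wellV_pos hp hy h).le

/-- The discriminant is 4(p+1)p²(p-11), negative for p < 11, while for p ≥ 6 no coefficient is
negative; the two ranges overlap. This quadratic in x = y^p is the factor of V in the numerator of
(V/V'²)''. -/
lemma convexity_coeff_pos (hp : 0 < p) {x : ℝ} (hx : 0 < x) :
    0 < (p + 1) * (4 * p + 6) * x ^ 2 + (p + 1) * (2 * p - 12) * x + 6 := by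
  rcases le_or_gt 6 p with h | h
  · have : 0 ≤ 2 * p - 12 := by linarith
    positivity
  · have hA : 0 < (p + 1) * (4 * p + 6) := by positivity
    have hd : 0 < (p + 1) * p ^ 2 * (11 - p) := by
      have : 0 < 11 - p := by linarith
      positivity
    have : 0 < 4 * ((p + 1) * (4 * p + 6)) *
        ((p + 1) * (4 * p + 6) * x ^ 2 + (p + 1) * (2 * p - 12) * x + 6) := by
      nlinarith [sq_nonneg (2 * ((p + 1) * (4 * p + 6)) * x + (p + 1) * (2 * p - 12))]
    exact pos_of_mul_pos_right this (by positivity)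

/-- The auxiliary function `V - 3 y² (x - 1)² ((p + 1) x - 1) / B(x)`, `x = y ^ p`, comparing the
potential with the bound that the convexity of `V / V'²` requires. -/
noncomputable def convexityGap (p y : ℝ) : ℝ :=
  wellV p y - 3 * y ^ 2 * ((y ^ p - 1) ^ 2 * ((p + 1) * y ^ p - 1)) /
    ((p + 1) * (4 * p + 6) * (y ^ p) ^ 2 + (p + 1) * (2 * p - 12) * y ^ p + 6)

lemma hasDerivAt_convexityGap (hp : 0 < p) {y : ℝ} (hy : 0 < y) :
    HasDerivAt (convexityGap p)
      (y * (y ^ p) * (y ^ p - 1) ^ 3 * (p * (p + 1) * ((p + 1) * (4 * p + 6) * y ^ p + 6 * (p - 1))) /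
        ((p + 1) * (4 * p + 6) * (y ^ p) ^ 2 + (p + 1) * (2 * p - 12) * y ^ p + 6) ^ 2) y := by
  have hx : 0 < y ^ p := Real.rpow_pos_of_pos hy p
  have hB := (convexity_coeff_pos hp hx).ne'
  have hd := hasDerivAt_rpow_div p hy
  have hN := ((hasDerivAt_pow 2 y).const_mul 3).mul (((hd.sub_const 1).pow 2).mul
    ((hd.const_mul (p + 1)).sub_const 1))
  have hD := (((hd.pow 2).const_mul ((p + 1) * (4 * p + 6))).add
    (hd.const_mul ((p + 1) * (2 * p - 12)))).add_const 6
  have h := (hasDerivAt_wellV hp hy).sub (hN.div hD hB)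
  refine h.congr_deriv ?_
  unfold wellV'
  simp only [Pi.pow_apply, Pi.mul_apply, Pi.add_apply]
  have hB2 := pow_ne_zero 2 hB
  rw [eq_div_iff hB2, sub_mul, div_mul_cancel₀ _ hB2]
  generalize y ^ p = x
  field_simp
  push_cast
  ring

lemma convexityGap_one (hp : 0 < p) : convexityGap p 1 = 0 := by
  simp [convexityGap, hp]

lemma convexityGap_pos (hp : 0 < p) {y : ℝ} (hy : 0 < y) (hy1 : y ≠ 1)
    (hyp : 1 < (p + 1) * y ^ p) : 0 < convexityGap p y := by
  -- The bound (p+1)u^p > 1 makes this factor larger than (4p+6) + 6(p-1) = 10p, so the derivative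
  -- of the gap has the sign of u^p - 1 and the gap is smallest at 1.
  have hfac : ∀ u, 0 < u → 1 < (p + 1) * u ^ p →
      0 < (p + 1) * (4 * p + 6) * u ^ p + 6 * (p - 1) := by
    intro u _ h1
    nlinarith
  rw [← convexityGap_one hp]
  rcases lt_or_gt_of_ne hy1 with h | h
  · have hanti : StrictAntiOn (convexityGap p) (Icc y 1) := by
      refine strictAntiOn_of_deriv_neg (convex_Icc y 1) (fun u hu =>
        (hasDerivAt_convexityGap hp (hy.trans_le hu.1)).continuousAt.continuousWithinAt) ?_
      intro u hu
      rw [interior_Icc] at hu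
      have hu0 := hy.trans hu.1
      have hx : 0 < u ^ p := Real.rpow_pos_of_pos hu0 p
      have hB := convexity_coeff_pos hp hx
      rw [(hasDerivAt_convexityGap hp hu0).deriv]
      have h1 : 0 < (p + 1) * (4 * p + 6) * u ^ p + 6 * (p - 1) := by
        refine hfac u hu0 (hyp.trans ?_)
        have := Real.rpow_lt_rpow hy.le hu.1 hp
        gcongr
      have h3 : (u ^ p - 1) ^ 3 < 0 :=
        Odd.pow_neg (by decide) (rpow_sub_one_neg hp hu0 hu.2)
      refine div_neg_of_neg_of_pos ?_ (by positivity)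
      exact mul_neg_of_neg_of_pos (mul_neg_of_pos_of_neg (by positivity) h3) (by positivity)
    exact hanti ⟨le_rfl, h.le⟩ ⟨h.le, le_rfl⟩ h
  · have hmono : StrictMonoOn (convexityGap p) (Icc 1 y) := by
      refine strictMonoOn_of_deriv_pos (convex_Icc 1 y) (fun u hu =>
        (hasDerivAt_convexityGap hp (one_pos.trans_le hu.1)).continuousAt.continuousWithinAt) ?_
      intro u hu
      rw [interior_Icc] at hu
      have hu0 := one_pos.trans hu.1
      have hx : 0 < u ^ p := Real.rpow_pos_of_pos hu0 p
      have hB := convexity_coeff_pos hp hx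
      have hx1 := rpow_sub_one_pos hp hu.1
      rw [(hasDerivAt_convexityGap hp hu0).deriv]
      have h1 : 0 < (p + 1) * (4 * p + 6) * u ^ p + 6 * (p - 1) :=
        hfac u hu0 (by nlinarith)
      positivity
    exact hmono ⟨le_rfl, h.le⟩ ⟨h.le, le_rfl⟩ h

/-- The inequality expressing that `V / V'²` is strictly convex. -/
lemma chicone_pos (hp : 0 < p) {y : ℝ} (hy : 0 < y) (hy1 : y ≠ 1) :
    0 < 6 * wellV p y * wellV'' p y ^ 2 - 3 * wellV' p y ^ 2 * wellV'' p y
      - 2 * wellV p y * wellV' p y * wellV''' p y := by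
  have hx : 0 < y ^ p := Real.rpow_pos_of_pos hy p
  have hB := convexity_coeff_pos hp hx
  have hV := wellV_pos hp hy.le hy1
  have key : 6 * wellV p y * wellV'' p y ^ 2 - 3 * wellV' p y ^ 2 * wellV'' p y
      - 2 * wellV p y * wellV' p y * wellV''' p y =
      wellV p y * ((p + 1) * (4 * p + 6) * (y ^ p) ^ 2 + (p + 1) * (2 * p - 12) * y ^ p + 6)
        - 3 * y ^ 2 * ((y ^ p - 1) ^ 2 * ((p + 1) * y ^ p - 1)) := by
    unfold wellV' wellV'' wellV'''
    field_simp
    ring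
  rw [key]
  -- Where V'' ≤ 0 the subtracted term is nonpositive and nothing is left to prove; elsewhere
  -- division by the positive quadratic reduces the claim to the sign of the gap.
  rcases le_or_gt ((p + 1) * y ^ p) 1 with h | h
  · have : 0 ≤ 1 - (p + 1) * y ^ p := by linarith
    have h2 : 0 ≤ 3 * y ^ 2 * ((y ^ p - 1) ^ 2 * (1 - (p + 1) * y ^ p)) := by positivity
    have h3 := mul_pos hV hB
    linarith
  · have h2 := convexityGap_pos hp hy hy1 h
    unfold convexityGap at h2
    rw [sub_pos, div_lt_iff₀ hB] at h2
    linarith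

/-- `V / V'²`, extended by continuity. -/
noncomputable def wellPhi (p : ℝ) : ℝ → ℝ :=
  Function.update (fun y => wellV p y / wellV' p y ^ 2) 1 (1 / (2 * p))

/-- The derivative of `V / V'²`, extended by continuity. -/
noncomputable def wellPhi' (p : ℝ) : ℝ → ℝ :=
  Function.update (fun y => (wellV' p y ^ 2 - 2 * wellV p y * wellV'' p y) / wellV' p y ^ 3) 1
    (-(p + 1) / (3 * p))

lemma wellPhi_of_ne {y : ℝ} (hy : y ≠ 1) : wellPhi p y = wellV p y / wellV' p y ^ 2 :=
  Function.update_of_ne hy _ _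

@[simp] lemma wellPhi_one : wellPhi p 1 = 1 / (2 * p) := Function.update_self _ _ _

lemma wellPhi'_of_ne {y : ℝ} (hy : y ≠ 1) :
    wellPhi' p y = (wellV' p y ^ 2 - 2 * wellV p y * wellV'' p y) / wellV' p y ^ 3 :=
  Function.update_of_ne hy _ _

lemma eventually_pos_ne_one : ∀ᶠ y : ℝ in 𝓝[≠] 1, 0 < y ∧ y ≠ 1 := by
  refine Filter.Eventually.and ?_ self_mem_nhdsWithin
  exact nhdsWithin_le_nhds (lt_mem_nhds one_pos)

lemma eventually_wellV''_ne (hp : 0 < p) : ∀ᶠ y : ℝ in 𝓝[≠] 1, wellV'' p y ≠ 0 := by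
  have h := (hasDerivAt_wellV'' (p := p) one_pos).continuousAt
  refine nhdsWithin_le_nhds (h.eventually_ne ?_)
  simp [hp.ne']

lemma tendsto_wellPhi_aux (hp : 0 < p) :
    Tendsto (fun y => wellV p y / wellV' p y ^ 2) (𝓝[≠] 1) (𝓝 (1 / (2 * p))) := by
  have hc2 := (hasDerivAt_wellV'' (p := p) one_pos).continuousAt
  have hc1 := (hasDerivAt_wellV' (p := p) one_pos).continuousAt
  refine HasDerivAt.lhopital_zero_nhdsNE (f' := wellV' p)
    (g' := fun y => 2 * wellV' p y * wellV'' p y) ?_ ?_ ?_ ?_ ?_ ?_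
  · exact eventually_pos_ne_one.mono fun y hy => hasDerivAt_wellV hp hy.1
  · refine eventually_pos_ne_one.mono fun y hy => ?_
    refine ((hasDerivAt_wellV' (p := p) hy.1).pow 2).congr_deriv ?_
    simp
  · filter_upwards [eventually_pos_ne_one, eventually_wellV''_ne hp] with y hy h2
    exact mul_ne_zero (mul_ne_zero two_ne_zero (wellV'_ne_zero hp hy.1 hy.2)) h2
  · have := (continuous_wellV hp).tendsto 1
    rw [wellV_one hp] at this
    exact this.mono_left nhdsWithin_le_nhds
  · have := (hc1.tendsto).pow 2
    simp only [wellV'_one, ne_eq, OfNat.ofNat_ne_zero, not_false_eq_true, zero_pow] at this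
    exact this.mono_left nhdsWithin_le_nhds
  · have h : Tendsto (fun y => 1 / (2 * wellV'' p y)) (𝓝[≠] 1) (𝓝 (1 / (2 * p))) := by
      have := (hc2.tendsto.const_mul 2)
      rw [wellV''_one] at this
      exact (tendsto_const_nhds.div this (by positivity)).mono_left nhdsWithin_le_nhds
    refine h.congr' ?_
    filter_upwards [eventually_pos_ne_one, eventually_wellV''_ne hp] with y hy h2
    have := wellV'_ne_zero hp hy.1 hy.2
    field_simp

lemma tendsto_wellPhi'_aux (hp : 0 < p) :
    Tendsto (fun y => (wellV' p y ^ 2 - 2 * wellV p y * wellV'' p y) / wellV' p y ^ 3) (𝓝[≠] 1)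
      (𝓝 (-(p + 1) / (3 * p))) := by
  have hc0 := (hasDerivAt_wellV hp one_pos).continuousAt.tendsto
  have hc2 := (hasDerivAt_wellV'' (p := p) one_pos).continuousAt.tendsto
  have hc1 := (hasDerivAt_wellV' (p := p) one_pos).continuousAt.tendsto
  rw [wellV_one hp] at hc0
  rw [wellV'_one] at hc1
  rw [wellV''_one] at hc2
  have hc3 : Tendsto (wellV''' p) (𝓝 1) (𝓝 (p * (p + 1))) := by
    have : ContinuousAt (wellV''' p) 1 := by
      unfold wellV'''
      have : ContinuousAt (fun y : ℝ => y ^ p) 1 :=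
        Real.continuousAt_rpow_const _ _ (Or.inl one_ne_zero)
      fun_prop (disch := norm_num)
    simpa using this.tendsto
  refine HasDerivAt.lhopital_zero_nhdsNE (f' := fun y => -2 * wellV p y * wellV''' p y)
    (g' := fun y => 3 * wellV' p y ^ 2 * wellV'' p y) ?_ ?_ ?_ ?_ ?_ ?_
  · refine eventually_pos_ne_one.mono fun y hy => ?_
    have h := ((hasDerivAt_wellV' (p := p) hy.1).pow 2).sub
      (((hasDerivAt_wellV hp hy.1).const_mul 2).mul (hasDerivAt_wellV'' (p := p) hy.1))
    refine h.congr_deriv ?_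
    simp
  · refine eventually_pos_ne_one.mono fun y hy => ?_
    refine ((hasDerivAt_wellV' (p := p) hy.1).pow 3).congr_deriv ?_
    simp
  · filter_upwards [eventually_pos_ne_one, eventually_wellV''_ne hp] with y hy h2
    have := wellV'_ne_zero hp hy.1 hy.2
    positivity
  · have := (hc1.pow 2).sub ((hc0.const_mul 2).mul hc2)
    simp only [ne_eq, OfNat.ofNat_ne_zero, not_false_eq_true, zero_pow, mul_zero, zero_mul,
      sub_zero] at this
    exact this.mono_left nhdsWithin_le_nhds
  · have := hc1.pow 3
    simp only [ne_eq, OfNat.ofNat_ne_zero, not_false_eq_true, zero_pow] at this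
    exact this.mono_left nhdsWithin_le_nhds
  -- The terms in V'V'' cancel when the numerator is differentiated, so the new quotient is Φ ·
  -- (-2V'''/(3V'')) and the limit of Φ can be reused.
  · have h : Tendsto (fun y => wellV p y / wellV' p y ^ 2 * (-2 * wellV''' p y / (3 * wellV'' p y)))
        (𝓝[≠] 1) (𝓝 (1 / (2 * p) * (-2 * (p * (p + 1)) / (3 * p)))) :=
      (tendsto_wellPhi_aux hp).mul (((hc3.const_mul (-2)).div (hc2.const_mul 3)
        (by positivity)).mono_left nhdsWithin_le_nhds)
    have e : 1 / (2 * p) * (-2 * (p * (p + 1)) / (3 * p)) = -(p + 1) / (3 * p) := by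
      field_simp
    rw [e] at h
    refine h.congr' ?_
    filter_upwards [eventually_pos_ne_one, eventually_wellV''_ne hp] with y hy h2
    have := wellV'_ne_zero hp hy.1 hy.2
    field_simp

lemma hasDerivAt_wellPhi (hp : 0 < p) {y : ℝ} (hy : 0 < y) :
    HasDerivAt (wellPhi p) (wellPhi' p y) y := by
  have hne : ∀ y : ℝ, 0 < y → y ≠ 1 → HasDerivAt (wellPhi p) (wellPhi' p y) y := by
    intro y hy hy1
    have hV := wellV'_ne_zero hp hy hy1
    have h := (hasDerivAt_wellV hp hy).div ((hasDerivAt_wellV' (p := p) hy).pow 2)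
      (by simpa using hV)
    rw [wellPhi'_of_ne hy1]
    refine (h.congr_of_eventuallyEq ?_).congr_deriv ?_
    · filter_upwards [eventually_ne_nhds hy1] with z hz
      simp [wellPhi_of_ne hz]
    · simp only [Pi.pow_apply]
      field_simp
      push_cast
      ring
  by_cases hy1 : y = 1
  · subst hy1
    refine hasDerivAt_of_eventually_hasDerivAt
      (eventually_pos_ne_one.mono fun y hy => hne y hy.1 hy.2) ?_ ?_
    · exact continuousAt_update_same.2 (tendsto_wellPhi_aux hp)
    · exact continuousAt_update_same.2 (tendsto_wellPhi'_aux hp)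
  · exact hne y hy hy1

lemma hasDerivAt_wellPhi'_of_ne (hp : 0 < p) {y : ℝ} (hy : 0 < y) (hy1 : y ≠ 1) :
    HasDerivAt (wellPhi' p)
      ((6 * wellV p y * wellV'' p y ^ 2 - 3 * wellV' p y ^ 2 * wellV'' p y
      - 2 * wellV p y * wellV' p y * wellV''' p y) / wellV' p y ^ 4) y := by
  have hV := wellV'_ne_zero hp hy hy1
  have h := (((hasDerivAt_wellV' (p := p) hy).pow 2).sub
      (((hasDerivAt_wellV hp hy).const_mul 2).mul (hasDerivAt_wellV'' (p := p) hy))).div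
      ((hasDerivAt_wellV' (p := p) hy).pow 3) (by simpa using hV)
  refine (h.congr_of_eventuallyEq ?_).congr_deriv ?_
  · filter_upwards [eventually_ne_nhds hy1] with z hz
    simp [wellPhi'_of_ne hz]
  · simp
    field_simp
    ring

lemma continuousAt_wellPhi' (hp : 0 < p) {y : ℝ} (hy : 0 < y) :
    ContinuousAt (wellPhi' p) y := by
  by_cases hy1 : y = 1
  · subst hy1
    exact continuousAt_update_same.2 (tendsto_wellPhi'_aux hp)
  · exact (hasDerivAt_wellPhi'_of_ne hp hy hy1).continuousAt

/-- Strict convexity of `V / V'²`. -/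
lemma wellPhi'_lt (hp : 0 < p) {a b : ℝ} (ha : 0 < a) (ha1 : a < 1) (hb : 1 < b) :
    wellPhi' p a < wellPhi' p b := by
  have hpos : ∀ u : ℝ, 0 < u → u ≠ 1 → 0 < deriv (wellPhi' p) u := by
    intro u hu hu1
    rw [(hasDerivAt_wellPhi'_of_ne hp hu hu1).deriv]
    have := wellV'_ne_zero hp hu hu1
    exact div_pos (chicone_pos hp hu hu1) (by positivity)
  -- Φ' is known to be differentiable only away from 1, so monotonicity is proved on each side and
  -- joined at 1 by continuity.
  have h1 : StrictMonoOn (wellPhi' p) (Icc a 1) := by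
    refine strictMonoOn_of_deriv_pos (convex_Icc a 1) (fun u hu =>
        (continuousAt_wellPhi' hp (ha.trans_le hu.1)).continuousWithinAt) fun u hu => ?_
    rw [interior_Icc] at hu
    exact hpos u (ha.trans hu.1) hu.2.ne
  have h2 : StrictMonoOn (wellPhi' p) (Icc 1 b) := by
    refine strictMonoOn_of_deriv_pos (convex_Icc 1 b) (fun u hu =>
        (continuousAt_wellPhi' hp (one_pos.trans_le hu.1)).continuousWithinAt) fun u hu => ?_
    rw [interior_Icc] at hu
    exact hpos u (one_pos.trans hu.1) hu.1.ne'
  exact (h1 ⟨le_rfl, ha1.le⟩ ⟨ha1.le, le_rfl⟩ ha1).trans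
    (h2 ⟨le_rfl, hb.le⟩ ⟨hb.le, le_rfl⟩ hb)

lemma wellPhi_pos (hp : 0 < p) {y : ℝ} (hy : 0 < y) : 0 < wellPhi p y := by
  by_cases hy1 : y = 1
  · subst hy1
    simp [hp]
  · rw [wellPhi_of_ne hy1]
    have := wellV'_ne_zero hp hy hy1
    have := wellV_pos hp hy.le hy1
    positivity

end Well

/-! ### The coordinate in which the potential becomes a square. -/

section Inverse

variable {p : ℝ}

/-- The amplitude at which positive solutions cease to exist: `wellRho p ^ 2 = wellV p 0`. -/
noncomputable def wellRho (p : ℝ) : ℝ := √(p / (2 * (p + 2)))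

lemma wellRho_pos (hp : 0 < p) : 0 < wellRho p := Real.sqrt_pos.2 (by positivity)

lemma wellRho_sq (hp : 0 < p) : wellRho p ^ 2 = wellV p 0 := by
  rw [wellRho, Real.sq_sqrt (by positivity), wellV_zero]

/-- The signed square root of the potential, continued linearly to `y ≤ 0`. -/
noncomputable def wellH (p y : ℝ) : ℝ :=
  if y ≤ 0 then y - wellRho p else if y ≤ 1 then -√(wellV p y) else √(wellV p y)

lemma wellH_of_nonpos {y : ℝ} (hy : y ≤ 0) : wellH p y = y - wellRho p := if_pos hy

lemma wellH_of_le_one (hp : 0 < p) {y : ℝ} (hy : 0 ≤ y) (hy1 : y ≤ 1) :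
    wellH p y = -√(wellV p y) := by
  rcases hy.eq_or_lt with rfl | h
  · rw [wellH_of_nonpos le_rfl, ← wellRho_sq hp, Real.sqrt_sq (wellRho_pos hp).le, zero_sub]
  · rw [wellH, if_neg (not_le.2 h), if_pos hy1]

lemma wellH_of_one_le (hp : 0 < p) {y : ℝ} (hy1 : 1 ≤ y) : wellH p y = √(wellV p y) := by
  rcases hy1.eq_or_lt with rfl | h
  · rw [wellH_of_le_one hp zero_le_one le_rfl, wellV_one hp]
    simp
  · rw [wellH, if_neg (by linarith), if_neg (by linarith)]

lemma wellH_one (hp : 0 < p) : wellH p 1 = 0 := by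
  rw [wellH_of_one_le hp le_rfl, wellV_one hp, Real.sqrt_zero]

lemma wellH_zero : wellH p 0 = -wellRho p := by
  rw [wellH_of_nonpos le_rfl, zero_sub]

lemma wellH_sq (hp : 0 < p) {y : ℝ} (hy : 0 ≤ y) : wellH p y ^ 2 = wellV p y := by
  have h := wellV_nonneg hp hy
  rcases le_total y 1 with h1 | h1
  · rw [wellH_of_le_one hp hy h1, neg_sq, Real.sq_sqrt h]
  · rw [wellH_of_one_le hp h1, Real.sq_sqrt h]

lemma strictMono_wellH (hp : 0 < p) : StrictMono (wellH p) := by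
  have h1 : StrictMonoOn (wellH p) (Iic 0) := by
    intro a ha b hb hab
    rw [wellH_of_nonpos ha, wellH_of_nonpos hb]
    linarith
  have h2 : StrictMonoOn (wellH p) (Icc 0 1) := by
    intro a ha b hb hab
    rw [wellH_of_le_one hp ha.1 ha.2, wellH_of_le_one hp hb.1 hb.2]
    exact neg_lt_neg (Real.sqrt_lt_sqrt (wellV_nonneg hp hb.1) (strictAntiOn_wellV hp ha hb hab))
  have h3 : StrictMonoOn (wellH p) (Ici 1) := by
    intro a ha b hb hab
    rw [wellH_of_one_le hp ha, wellH_of_one_le hp hb]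
    exact Real.sqrt_lt_sqrt (wellV_nonneg hp (zero_le_one.trans ha))
      (strictMonoOn_wellV hp ha hb hab)
  have h23 : StrictMonoOn (wellH p) (Ici 0) := by
    have := h2.union h3 (c := 1) ⟨⟨zero_le_one, le_rfl⟩, fun x hx => hx.2⟩
      ⟨mem_Ici.2 le_rfl, fun x hx => hx⟩
    rwa [Icc_union_Ici_eq_Ici zero_le_one] at this
  have := h1.union h23 (c := 0) ⟨mem_Iic.2 le_rfl, fun x hx => hx⟩
      ⟨mem_Ici.2 le_rfl, fun x hx => hx⟩
  rwa [Iic_union_Ici, strictMonoOn_univ] at this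

lemma continuous_wellH (hp : 0 < p) : Continuous (wellH p) := by
  have hV := continuous_wellV hp
  refine Continuous.if_le (by fun_prop) (Continuous.if_le (by fun_prop) (by fun_prop)
    continuous_id continuous_const ?_) continuous_id continuous_const ?_
  · rintro x rfl
    simp [wellV_one hp]
  · rintro x rfl
    rw [if_pos zero_le_one, ← wellRho_sq hp, Real.sqrt_sq (wellRho_pos hp).le, zero_sub]

lemma tendsto_wellV_atTop (hp : 0 < p) : Tendsto (wellV p) atTop atTop := by
  unfold wellV
  refine tendsto_atTop_add_const_right _ _ ?_
  refine (tendsto_pow_atTop two_ne_zero).atTop_mul_atTop₀ ?_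
  refine tendsto_atTop_add_const_right _ _ ?_
  exact (tendsto_rpow_atTop hp).atTop_div_const (by positivity)

/-- This is what the linear continuation to y ≤ 0 is for: h becomes a bijection of ℝ and its inverse
g is continuous everywhere, although only s > -ρ, that is g(s) > 0, matters later. -/
lemma surjective_wellH (hp : 0 < p) : Function.Surjective (wellH p) := by
  refine (continuous_wellH hp).surjective ?_ ?_
  · refine Tendsto.congr' (f₁ := fun y => √(wellV p y)) ?_
      (Real.tendsto_sqrt_atTop.comp (tendsto_wellV_atTop hp))
    filter_upwards [eventually_ge_atTop 1] with y hy
    rw [wellH_of_one_le hp hy]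
  · refine Tendsto.congr' (f₁ := fun y => y - wellRho p) ?_
      (tendsto_atBot_add_const_right _ _ tendsto_id)
    filter_upwards [eventually_le_atBot 0] with y hy
    rw [wellH_of_nonpos hy]

open Classical in
/-- The inverse function of `wellH`. -/
noncomputable def wellG (p : ℝ) : ℝ → ℝ :=
  if hp : 0 < p then
    ((strictMono_wellH hp).orderIsoOfSurjective _ (surjective_wellH hp)).symm
  else id

lemma wellG_eq (hp : 0 < p) :
    wellG p = ((strictMono_wellH hp).orderIsoOfSurjective _ (surjective_wellH hp)).symm :=
  dif_pos hp

lemma wellH_wellG (hp : 0 < p) (s : ℝ) : wellH p (wellG p s) = s := by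
  rw [wellG_eq hp]
  exact StrictMono.orderIsoOfSurjective_self_symm_apply _ _ _ _

lemma wellG_wellH (hp : 0 < p) (y : ℝ) : wellG p (wellH p y) = y := by
  rw [wellG_eq hp]
  exact StrictMono.orderIsoOfSurjective_symm_apply_self _ _ _ _

lemma continuous_wellG (hp : 0 < p) : Continuous (wellG p) := by
  rw [wellG_eq hp]
  exact OrderIso.continuous _

lemma strictMono_wellG (hp : 0 < p) : StrictMono (wellG p) := by
  rw [wellG_eq hp]
  exact OrderIso.strictMono _

lemma wellG_zero (hp : 0 < p) : wellG p 0 = 1 := by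
  rw [← wellH_one hp, wellG_wellH hp]

lemma wellG_neg_rho (hp : 0 < p) : wellG p (-wellRho p) = 0 := by
  rw [← wellH_zero, wellG_wellH hp]

lemma wellG_pos (hp : 0 < p) {s : ℝ} (hs : -wellRho p < s) : 0 < wellG p s := by
  rw [← wellG_neg_rho hp]
  exact strictMono_wellG hp hs

lemma wellV_wellG (hp : 0 < p) {s : ℝ} (hs : -wellRho p < s) : wellV p (wellG p s) = s ^ 2 := by
  rw [← wellH_sq hp (wellG_pos hp hs).le, wellH_wellG hp]

/-- The derivative of `wellG`. -/
noncomputable def wellG' (p s : ℝ) : ℝ := 2 * √(wellPhi p (wellG p s))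

lemma wellG'_pos (hp : 0 < p) {s : ℝ} (hs : -wellRho p < s) : 0 < wellG' p s := by
  have := wellPhi_pos hp (wellG_pos hp hs)
  unfold wellG'
  positivity

/-- `V' (g s) * g' s = 2 s`. -/
lemma wellV'_wellG_mul (hp : 0 < p) {s : ℝ} (hs : -wellRho p < s) :
    wellV' p (wellG p s) * wellG' p s = 2 * s := by
  have hy := wellG_pos hp hs
  by_cases h1 : wellG p s = 1
  · have : s = 0 := by rw [← wellH_wellG hp s, h1, wellH_one hp]
    subst this
    rw [h1, wellV'_one]
    ring
  · unfold wellG'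
    have hV := wellV'_ne_zero hp hy h1
    rw [wellPhi_of_ne h1, wellV_wellG hp hs, ← div_pow, Real.sqrt_sq_eq_abs, abs_div]
    rcases lt_or_gt_of_ne h1 with h | h
    · have hs : s < 0 := by
        rw [← wellG_zero hp] at h
        exact (strictMono_wellG hp).lt_iff_lt.1 h
      rw [abs_of_neg hs, abs_of_neg (wellV'_neg hp hy h)]
      field_simp
    · have hs : 0 < s := by
        rw [← wellG_zero hp] at h
        exact (strictMono_wellG hp).lt_iff_lt.1 h
      rw [abs_of_pos hs, abs_of_pos (wellV'_pos hp h)]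
      field_simp

lemma continuousAt_wellG' (hp : 0 < p) {s : ℝ} (hs : -wellRho p < s) :
    ContinuousAt (wellG' p) s := by
  have h := (hasDerivAt_wellPhi hp (wellG_pos hp hs)).continuousAt
  exact (ContinuousAt.comp (f := wellG p) h (continuous_wellG hp).continuousAt).sqrt.const_mul 2

lemma hasDerivAt_wellG (hp : 0 < p) {s : ℝ} (hs : -wellRho p < s) :
    HasDerivAt (wellG p) (wellG' p s) s := by
  have hne : ∀ t, -wellRho p < t → t ≠ 0 → HasDerivAt (wellG p) (wellG' p t) t := by
    intro t ht ht0
    have hy := wellG_pos hp ht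
    have hm := wellV'_wellG_mul hp ht
    have h1 : wellG p t ≠ 1 := fun h => ht0 (by rw [← wellH_wellG hp t, h, wellH_one hp])
    have hV : wellV p (wellG p t) ≠ 0 := (wellV_pos hp hy.le h1).ne'
    have hV' := wellV'_ne_zero hp hy h1
    have hd : HasDerivAt (wellH p) (wellV' p (wellG p t) / (2 * t)) (wellG p t) := by
      have hs := (hasDerivAt_wellV hp hy).sqrt hV
      have hsq := wellV_wellG hp ht
      rcases lt_or_gt_of_ne h1 with h | h
      · have ht : t < 0 := by
          rw [← wellG_zero hp] at h
          exact (strictMono_wellG hp).lt_iff_lt.1 h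
        refine (hs.neg.congr_of_eventuallyEq ?_).congr_deriv ?_
        · filter_upwards [eventually_gt_nhds hy, eventually_lt_nhds h] with z hz hz1
          exact wellH_of_le_one hp hz.le hz1.le
        · rw [hsq, Real.sqrt_sq_eq_abs, abs_of_neg ht]
          field_simp
      · have ht : 0 < t := by
          rw [← wellG_zero hp] at h
          exact (strictMono_wellG hp).lt_iff_lt.1 h
        refine (hs.congr_of_eventuallyEq ?_).congr_deriv ?_
        · filter_upwards [eventually_gt_nhds h] with z hz1
          exact wellH_of_one_le hp hz1.le
        · rw [hsq, Real.sqrt_sq_eq_abs, abs_of_pos ht]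
    refine (hd.of_local_left_inverse (continuous_wellG hp).continuousAt
      (div_ne_zero hV' (by simpa using ht0)) (Eventually.of_forall (wellH_wellG hp))).congr_deriv ?_
    rw [inv_div, ← hm]
    field_simp
  by_cases h0 : s = 0
  · subst h0
    -- At s = 0 the square root of V degenerates and the inverse function rule is not available; the
    -- derivative is obtained as the limit of the nearby ones.
    refine hasDerivAt_of_eventually_hasDerivAt ?_ (continuous_wellG hp).continuousAt
      (continuousAt_wellG' hp hs)
    filter_upwards [nhdsWithin_le_nhds (lt_mem_nhds hs), self_mem_nhdsWithin] with t ht ht0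
    exact hne t ht ht0
  · exact hne s hs h0

/-- The chain rule gives Φ'(g) g'/√Φ(g), and g' = 2√Φ(g) cancels the root. Thus the second
derivative of g carries the sign information of Φ' alone. -/
lemma hasDerivAt_wellG' (hp : 0 < p) {s : ℝ} (hs : -wellRho p < s) :
    HasDerivAt (wellG' p) (2 * wellPhi' p (wellG p s)) s := by
  have hy := wellG_pos hp hs
  have hφ := wellPhi_pos hp hy
  have h := (((hasDerivAt_wellPhi hp hy).comp s (hasDerivAt_wellG hp hs)).sqrt hφ.ne').const_mul 2
  refine h.congr_deriv ?_
  have := Real.sqrt_pos.2 hφ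
  simp only [Function.comp, wellG']
  field_simp

lemma wellG'_zero (hp : 0 < p) : wellG' p 0 = 2 * √(1 / (2 * p)) := by
  rw [wellG', wellG_zero hp, wellPhi_one]

/-- The symmetrised derivative of `wellG`; its average is the period. -/
noncomputable def wellSym (p s : ℝ) : ℝ := wellG' p s + wellG' p (-s)

lemma wellSym_neg (s : ℝ) : wellSym p (-s) = wellSym p s := by
  rw [wellSym, wellSym, neg_neg, add_comm]

lemma strictMonoOn_wellSym (hp : 0 < p) : StrictMonoOn (wellSym p) (Ico 0 (wellRho p)) := by
  have hd : ∀ s, -wellRho p < s → s < wellRho p → HasDerivAt (wellSym p)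
      (2 * wellPhi' p (wellG p s) - 2 * wellPhi' p (wellG p (-s))) s := by
    intro s h1 h2
    have hc := (hasDerivAt_wellG' hp (s := -s) (by linarith)).comp s (hasDerivAt_neg s)
    exact ((hasDerivAt_wellG' hp h1).add hc).congr_deriv (by ring)
  have hρ := wellRho_pos hp
  refine strictMonoOn_of_deriv_pos (convex_Ico _ _) (fun s hs =>
    (hd s (by linarith [hs.1]) hs.2).continuousAt.continuousWithinAt) fun s hs => ?_
  rw [interior_Ico] at hs
  rw [(hd s (by linarith [hs.1]) hs.2).deriv]
  have h1 : 1 < wellG p s := by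
    rw [← wellG_zero hp]
    exact strictMono_wellG hp hs.1
  have h2 : wellG p (-s) < 1 := by
    rw [← wellG_zero hp]
    exact strictMono_wellG hp (by linarith [hs.1])
  have h3 := wellPhi'_lt hp (wellG_pos hp (s := -s) (by linarith [hs.2])) h2 h1
  linarith

/-- Blow-up of the derivative of `wellG` at the lower end of its range. -/
lemma le_wellG'_neg (hp : 0 < p) {s : ℝ} (hs : 0 < s) (hsρ : s < wellRho p) :
    2 * wellRho p * s / √(wellRho p ^ 2 - s ^ 2) ≤ wellG' p (-s) := by
  have hs' : -wellRho p < -s := by linarith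
  have hρ := wellRho_pos hp
  have hy := wellG_pos hp hs'
  have hy1 : wellG p (-s) < 1 := by
    rw [← wellG_zero hp]
    exact strictMono_wellG hp (by linarith)
  have hm := wellV'_wellG_mul hp hs'
  have hV := wellV_wellG hp hs'
  have hg := wellG'_pos hp hs'
  have hρ2 : wellRho p ^ 2 = p / (2 * (p + 2)) := by rw [wellRho_sq hp, wellV_zero]
  set y := wellG p (-s) with hydef
  have hx0 : 0 < y ^ p := Real.rpow_pos_of_pos hy p
  have hx1 := rpow_sub_one_neg hp hy hy1
  have hd : 0 < wellRho p ^ 2 - s ^ 2 := by nlinarith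
  -- As s approaches ρ the point y = g(-s) approaches 0; the exact value of ρ² - V(y) - ρ²y² shows
  -- that y is at most √(ρ² - s²)/ρ.
  have hbound : wellRho p * y ≤ √(wellRho p ^ 2 - s ^ 2) := by
    refine Real.le_sqrt_of_sq_le ?_
    have e : wellRho p ^ 2 - s ^ 2 - (wellRho p * y) ^ 2 = y ^ 2 * (1 - y ^ p) / (p + 2) := by
      have : s ^ 2 = wellV p y := by rw [hV, neg_sq]
      rw [this, mul_pow, hρ2, wellV]
      field_simp
      ring
    have : 0 ≤ y ^ 2 * (1 - y ^ p) / (p + 2) := by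
      have : 0 ≤ 1 - y ^ p := by linarith
      positivity
    linarith
  rw [div_le_iff₀ (Real.sqrt_pos.2 hd)]
  -- V'(y) > -y, so the relation V'(g)g' = 2·(-s) forces g' to be at least 2s/y.
  have h1 : 2 * s ≤ y * wellG' p (-s) := by
    have : wellV' p y = y * y ^ p - y := by unfold wellV'; ring
    rw [this] at hm
    have : 0 < y * y ^ p * wellG' p (-s) := by positivity
    nlinarith
  calc 2 * wellRho p * s = wellRho p * (2 * s) := by ring
    _ ≤ wellRho p * (y * wellG' p (-s)) := by gcongr
    _ = wellG' p (-s) * (wellRho p * y) := by ring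
    _ ≤ _ := by gcongr

end Inverse

/-! ### Orbits parametrised by an angle. -/

section Orbit

variable {p r : ℝ}

lemma neg_rho_lt_mul_sin {ρ : ℝ} (hr : r ∈ Ioo (-ρ) ρ) (θ : ℝ) : -ρ < r * Real.sin θ := by
  have h1 : |r * Real.sin θ| ≤ |r| := by
    rw [abs_mul]
    exact mul_le_of_le_one_right (abs_nonneg _) (Real.abs_sin_le_one _)
  have h2 : |r| < ρ := abs_lt.2 hr
  exact (abs_lt.1 (h1.trans_lt h2)).1

/-- `dt/dθ` along the orbit of amplitude `r`, where `y = g (r sin θ)`. -/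
noncomputable def orbitSpeed (p r θ : ℝ) : ℝ := wellG' p (r * Real.sin θ) / √2

lemma orbitSpeed_pos (hp : 0 < p) (hr : r ∈ Ioo (-wellRho p) (wellRho p)) (θ : ℝ) :
    0 < orbitSpeed p r θ :=
  div_pos (wellG'_pos hp (neg_rho_lt_mul_sin hr θ)) (by positivity)

lemma continuous_wellG'_mul_sin (hp : 0 < p) :
    Continuous fun x : Ioo (-wellRho p) (wellRho p) × ℝ => wellG' p (x.1 * Real.sin x.2) := by
  rw [continuous_iff_continuousAt]
  intro x
  exact ContinuousAt.comp (f := fun x : Ioo (-wellRho p) (wellRho p) × ℝ => (x.1 : ℝ) * Real.sin x.2)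
    (continuousAt_wellG' hp (neg_rho_lt_mul_sin x.1.2 x.2)) (by fun_prop)

lemma continuous_orbitSpeed_uncurry (hp : 0 < p) :
    Continuous fun x : Ioo (-wellRho p) (wellRho p) × ℝ => orbitSpeed p x.1 x.2 :=
  (continuous_wellG'_mul_sin hp).div_const _

lemma continuous_orbitSpeed (hp : 0 < p) (hr : r ∈ Ioo (-wellRho p) (wellRho p)) :
    Continuous (orbitSpeed p r) :=
  (continuous_orbitSpeed_uncurry hp).comp (Continuous.prodMk_right (⟨r, hr⟩ : Ioo _ _))

lemma periodic_orbitSpeed : Function.Periodic (orbitSpeed p r) (2 * Real.pi) := fun θ => by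
  simp [orbitSpeed]

/-- The time at which the orbit of amplitude `r` reaches the angle `θ`. -/
noncomputable def orbitTime (p r θ : ℝ) : ℝ := ∫ u in (0 : ℝ)..θ, orbitSpeed p r u

/-- The period of the orbit of amplitude `r`. -/
noncomputable def orbitPeriod (p r : ℝ) : ℝ := orbitTime p r (2 * Real.pi)

lemma hasDerivAt_orbitTime (hp : 0 < p) (hr : r ∈ Ioo (-wellRho p) (wellRho p)) (θ : ℝ) :
    HasDerivAt (orbitTime p r) (orbitSpeed p r θ) θ :=
  ((continuous_orbitSpeed hp hr).integral_hasStrictDerivAt 0 θ).hasDerivAt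

lemma strictMono_orbitTime (hp : 0 < p) (hr : r ∈ Ioo (-wellRho p) (wellRho p)) :
    StrictMono (orbitTime p r) :=
  strictMono_of_deriv_pos fun θ => by
    rw [(hasDerivAt_orbitTime hp hr θ).deriv]
    exact orbitSpeed_pos hp hr θ

lemma orbitTime_zero : orbitTime p r 0 = 0 := intervalIntegral.integral_same

lemma orbitTime_add_two_pi (hp : 0 < p) (hr : r ∈ Ioo (-wellRho p) (wellRho p)) (θ : ℝ) :
    orbitTime p r (θ + 2 * Real.pi) = orbitTime p r θ + orbitPeriod p r := by
  have hc := continuous_orbitSpeed hp hr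
  unfold orbitPeriod orbitTime
  rw [← intervalIntegral.integral_add_adjacent_intervals (hc.intervalIntegrable 0 θ)
    (hc.intervalIntegrable θ _), periodic_orbitSpeed.intervalIntegral_add_eq θ 0, zero_add]

lemma orbitPeriod_pos (hp : 0 < p) (hr : r ∈ Ioo (-wellRho p) (wellRho p)) :
    0 < orbitPeriod p r := by
  rw [orbitPeriod, ← orbitTime_zero (p := p) (r := r)]
  exact strictMono_orbitTime hp hr Real.two_pi_pos

lemma orbitTime_add_int_mul (hp : 0 < p) (hr : r ∈ Ioo (-wellRho p) (wellRho p)) (n : ℤ) :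
    orbitTime p r (n * (2 * Real.pi)) = n * orbitPeriod p r := by
  induction n with
  | zero => simp [orbitTime_zero]
  | succ n ih =>
    push_cast at ih ⊢
    rw [add_one_mul, orbitTime_add_two_pi hp hr, ih]
    ring
  | pred n ih =>
    have h := orbitTime_add_two_pi hp hr (((-n - 1 : ℤ) : ℝ) * (2 * Real.pi))
    have e : ((-n - 1 : ℤ) : ℝ) * (2 * Real.pi) + 2 * Real.pi = ((-n : ℤ) : ℝ) * (2 * Real.pi) := by
      push_cast
      ring
    rw [e, ih] at h
    push_cast at h ⊢
    linarith

lemma surjective_orbitTime (hp : 0 < p) (hr : r ∈ Ioo (-wellRho p) (wellRho p)) :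
    Function.Surjective (orbitTime p r) := by
  have hc : Continuous (orbitTime p r) :=
    continuous_iff_continuousAt.2 fun θ => (hasDerivAt_orbitTime hp hr θ).continuousAt
  have hP := orbitPeriod_pos hp hr
  intro t
  obtain ⟨n, hn⟩ := exists_int_gt (t / orbitPeriod p r)
  obtain ⟨m, hm⟩ := exists_int_lt (t / orbitPeriod p r)
  rw [div_lt_iff₀ hP, ← orbitTime_add_int_mul hp hr] at hn
  rw [lt_div_iff₀ hP, ← orbitTime_add_int_mul hp hr] at hm
  exact mem_range_of_exists_le_of_exists_ge hc ⟨_, hm.le⟩ ⟨_, hn.le⟩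

open Classical in
/-- The angle as a function of time along the orbit of amplitude `r`. -/
noncomputable def orbitAngle (p r : ℝ) : ℝ → ℝ :=
  if h : 0 < p ∧ r ∈ Ioo (-wellRho p) (wellRho p) then
    ((strictMono_orbitTime h.1 h.2).orderIsoOfSurjective _ (surjective_orbitTime h.1 h.2)).symm
  else id

lemma orbitAngle_eq (hp : 0 < p) (hr : r ∈ Ioo (-wellRho p) (wellRho p)) : orbitAngle p r =
    ((strictMono_orbitTime hp hr).orderIsoOfSurjective _ (surjective_orbitTime hp hr)).symm :=
  dif_pos ⟨hp, hr⟩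

lemma orbitTime_orbitAngle (hp : 0 < p) (hr : r ∈ Ioo (-wellRho p) (wellRho p)) (t : ℝ) :
    orbitTime p r (orbitAngle p r t) = t := by
  rw [orbitAngle_eq hp hr]
  exact StrictMono.orderIsoOfSurjective_self_symm_apply _ _ _ _

lemma orbitAngle_orbitTime (hp : 0 < p) (hr : r ∈ Ioo (-wellRho p) (wellRho p)) (θ : ℝ) :
    orbitAngle p r (orbitTime p r θ) = θ := by
  rw [orbitAngle_eq hp hr]
  exact StrictMono.orderIsoOfSurjective_symm_apply_self _ _ _ _

lemma continuous_orbitAngle (hp : 0 < p) (hr : r ∈ Ioo (-wellRho p) (wellRho p)) :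
    Continuous (orbitAngle p r) := by
  rw [orbitAngle_eq hp hr]
  exact OrderIso.continuous _

lemma strictMono_orbitAngle (hp : 0 < p) (hr : r ∈ Ioo (-wellRho p) (wellRho p)) :
    StrictMono (orbitAngle p r) := by
  rw [orbitAngle_eq hp hr]
  exact OrderIso.strictMono _

lemma orbitAngle_add_period (hp : 0 < p) (hr : r ∈ Ioo (-wellRho p) (wellRho p)) (t : ℝ) :
    orbitAngle p r (t + orbitPeriod p r) = orbitAngle p r t + 2 * Real.pi := by
  apply (strictMono_orbitTime hp hr).injective
  rw [orbitTime_orbitAngle hp hr, orbitTime_add_two_pi hp hr, orbitTime_orbitAngle hp hr]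

lemma hasDerivAt_orbitAngle (hp : 0 < p) (hr : r ∈ Ioo (-wellRho p) (wellRho p)) (t : ℝ) :
    HasDerivAt (orbitAngle p r) (orbitSpeed p r (orbitAngle p r t))⁻¹ t :=
  (hasDerivAt_orbitTime hp hr _).of_local_left_inverse (continuous_orbitAngle hp hr).continuousAt
    (orbitSpeed_pos hp hr _).ne' (Eventually.of_forall (orbitTime_orbitAngle hp hr))

/-- The periodic solution of amplitude `r`. -/
noncomputable def orbit (p r t : ℝ) : ℝ := wellG p (r * Real.sin (orbitAngle p r t))

lemma orbit_pos (hp : 0 < p) (hr : r ∈ Ioo (-wellRho p) (wellRho p)) (t : ℝ) :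
    0 < orbit p r t := wellG_pos hp (neg_rho_lt_mul_sin hr _)

/-- The factor g' from the chain rule cancels against the one in dt/dθ. What remains, √2 r cos θ, is
regular also at the turning points, where the usual time integral dy/y' is singular. -/
lemma hasDerivAt_orbit (hp : 0 < p) (hr : r ∈ Ioo (-wellRho p) (wellRho p)) (t : ℝ) :
    HasDerivAt (orbit p r) (√2 * (r * Real.cos (orbitAngle p r t))) t := by
  have hs := neg_rho_lt_mul_sin hr (orbitAngle p r t)
  have h1 := ((hasDerivAt_orbitAngle hp hr t).sin).const_mul r
  refine ((hasDerivAt_wellG hp hs).comp t h1).congr_deriv ?_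
  have := (wellG'_pos hp hs).ne'
  unfold orbitSpeed
  have : (√2 : ℝ) ≠ 0 := by positivity
  field_simp

lemma deriv_orbit (hp : 0 < p) (hr : r ∈ Ioo (-wellRho p) (wellRho p)) :
    deriv (orbit p r) = fun t => √2 * (r * Real.cos (orbitAngle p r t)) :=
  funext fun t => (hasDerivAt_orbit hp hr t).deriv

/-- Differentiating once more gives -2s/g'(s) with s = r sin θ, and V'(g(s)) g'(s) = 2s identifies
this with the force. -/
lemma hasDerivAt_deriv_orbit (hp : 0 < p) (hr : r ∈ Ioo (-wellRho p) (wellRho p)) (t : ℝ) :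
    HasDerivAt (deriv (orbit p r)) (-wellV' p (orbit p r t)) t := by
  have hs := neg_rho_lt_mul_sin hr (orbitAngle p r t)
  rw [deriv_orbit hp hr]
  have h1 := (((hasDerivAt_orbitAngle hp hr t).cos).const_mul r).const_mul √2
  refine h1.congr_deriv ?_
  have hg := (wellG'_pos hp hs).ne'
  have hm := wellV'_wellG_mul hp hs
  have h2 : (√2 : ℝ) ≠ 0 := by positivity
  have hsq : (√2 : ℝ) ^ 2 = 2 := Real.sq_sqrt (by norm_num)
  unfold orbitSpeed orbit
  field_simp
  rw [hsq]
  linarith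

lemma contDiff_two_of_hasDerivAt {y f : ℝ → ℝ} (h1 : Differentiable ℝ y)
    (h2 : ∀ t, HasDerivAt (deriv y) (f t) t) (hf : Continuous f) : ContDiff ℝ 2 y := by
  have : ContDiff ℝ (1 + 1) y := by
    rw [contDiff_succ_iff_deriv]
    refine ⟨h1, by simp, ?_⟩
    rw [contDiff_one_iff_deriv]
    refine ⟨fun t => (h2 t).differentiableAt, ?_⟩
    rwa [show deriv (deriv y) = f from funext fun t => (h2 t).deriv]
  exact this

lemma wellV'_eq {y : ℝ} (hy : 0 < y) : wellV' p y = y ^ (p + 1) - y := by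
  rw [wellV', Real.rpow_add_one hy.ne']
  ring

lemma continuous_wellV' (hp : 0 < p) : Continuous (wellV' p) := by
  unfold wellV'
  have : Continuous fun y : ℝ => y ^ p := Real.continuous_rpow_const hp.le
  fun_prop

lemma continuous_orbit (hp : 0 < p) (hr : r ∈ Ioo (-wellRho p) (wellRho p)) :
    Continuous (orbit p r) :=
  continuous_iff_continuousAt.2 fun t => (hasDerivAt_orbit hp hr t).continuousAt

lemma periodic_orbit (hp : 0 < p) (hr : r ∈ Ioo (-wellRho p) (wellRho p)) :
    Function.Periodic (orbit p r) (orbitPeriod p r) := fun t => by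
  rw [orbit, orbitAngle_add_period hp hr, Real.sin_add_two_pi, orbit]

lemma orbit_isPosPeriodicSolution {q T : ℝ} (hq : 2 < q)
    (hr : r ∈ Ioo (-wellRho (q - 2)) (wellRho (q - 2)))
    (hT : Function.Periodic (orbit (q - 2) r) (2 * T)) :
    IsPosPeriodicSolution q T (orbit (q - 2) r) := by
  have hp : 0 < q - 2 := sub_pos.2 hq
  refine ⟨?_, orbit_pos hp hr, hT, fun x => ?_⟩
  · exact contDiff_two_of_hasDerivAt (fun t => (hasDerivAt_orbit hp hr t).differentiableAt)
      (hasDerivAt_deriv_orbit hp hr) ((continuous_wellV' hp).comp (continuous_orbit hp hr)).neg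
  · rw [(hasDerivAt_deriv_orbit hp hr x).deriv, wellV'_eq (orbit_pos hp hr x),
      show q - 2 + 1 = q - 1 by ring]
    ring

/-- A time at which the orbit attains its maximum. -/
lemma orbit_at_max (hp : 0 < p) (hr : r ∈ Ioo (-wellRho p) (wellRho p)) :
    orbit p r (orbitTime p r (Real.pi / 2)) = wellG p r := by
  rw [orbit, orbitAngle_orbitTime hp hr, Real.sin_pi_div_two, mul_one]

lemma deriv_orbit_at_max (hp : 0 < p) (hr : r ∈ Ioo (-wellRho p) (wellRho p)) :
    deriv (orbit p r) (orbitTime p r (Real.pi / 2)) = 0 := by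
  rw [deriv_orbit hp hr]
  simp [orbitAngle_orbitTime hp hr]

/-- For r > 0 the maximum g(r) is reached only where sin θ = 1, once per turn, so a shorter period
would place a second maximum strictly inside a turn. At r = 0 the orbit is constant, hence the
exclusion. -/
lemma hasMinimalPeriod_orbit (hp : 0 < p) (hr : r ∈ Ioo 0 (wellRho p)) :
    HasMinimalPeriod (orbit p r) (orbitPeriod p r) := by
  have hr' : r ∈ Ioo (-wellRho p) (wellRho p) := ⟨by linarith [hr.1, wellRho_pos hp], hr.2⟩
  refine ⟨⟨orbitPeriod_pos hp hr', periodic_orbit hp hr'⟩, ?_⟩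
  rintro s ⟨hs, hper⟩
  by_contra! hlt
  set t := orbitTime p r (Real.pi / 2) with ht
  have h1 : orbit p r (t + s) = wellG p r := by rw [hper, ht, orbit_at_max hp hr']
  have h2 := (strictMono_wellG hp).injective h1
  have h3 : Real.sin (orbitAngle p r (t + s)) = 1 := by
    rwa [mul_eq_left₀ hr.1.ne'] at h2
  have h4 : Real.pi / 2 < orbitAngle p r (t + s) := by
    have := strictMono_orbitAngle hp hr' (show t < t + s by linarith)
    rwa [ht, orbitAngle_orbitTime hp hr', ← ht] at this
  have h5 : orbitAngle p r (t + s) < Real.pi / 2 + 2 * Real.pi := by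
    have := strictMono_orbitAngle hp hr' (show t + s < t + orbitPeriod p r by linarith)
    rwa [orbitAngle_add_period hp hr', ht, orbitAngle_orbitTime hp hr', ← ht] at this
  obtain ⟨n, hn⟩ := (Real.sin_eq_one_iff).1 h3
  have hpi := Real.pi_pos
  rw [← hn] at h4 h5
  have h6 : (0 : ℝ) < n := by
    by_contra! h
    nlinarith
  have h7 : (n : ℝ) < 1 := by
    by_contra! h
    nlinarith
  norm_cast at h6 h7
  omega

end Orbit

/-! ### The period as a function of the amplitude. -/

section Period

variable {p r : ℝ}

lemma continuousOn_orbitPeriod (hp : 0 < p) :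
    ContinuousOn (orbitPeriod p) (Ioo (-wellRho p) (wellRho p)) := by
  rw [continuousOn_iff_continuous_domRestrict]
  exact intervalIntegral.continuous_parametric_intervalIntegral_of_continuous'
    (f := fun (x : Ioo (-wellRho p) (wellRho p)) θ => orbitSpeed p x θ)
    (continuous_orbitSpeed_uncurry hp) 0 (2 * Real.pi)

lemma orbitPeriod_zero (hp : 0 < p) : orbitPeriod p 0 = 2 * Real.pi / √p := by
  have h : ∀ θ, orbitSpeed p 0 θ = 1 / √p := by
    intro θ
    rw [orbitSpeed, zero_mul, wellG'_zero hp, Real.sqrt_div zero_le_one, Real.sqrt_one,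
      Real.sqrt_mul zero_le_two]
    have h2 : (√2 : ℝ) ≠ 0 := by positivity
    have h3 : (√p : ℝ) ≠ 0 := (Real.sqrt_pos.2 hp).ne'
    have hsq : (√2 : ℝ) ^ 2 = 2 := Real.sq_sqrt (by norm_num)
    field_simp
    linarith
  unfold orbitPeriod orbitTime
  simp only [h]
  rw [intervalIntegral.integral_const]
  simp [div_eq_mul_inv]

/-- Averaging the integrand with its shift by π replaces g' by its symmetrisation. That function is
even, so sin θ may be replaced by |sin θ|, which for r ≥ 0 keeps the argument in [0, ρ), where the
symmetrisation is monotone. -/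
lemma orbitPeriod_eq_integral_wellSym (hp : 0 < p) (hr : r ∈ Ioo (-wellRho p) (wellRho p)) :
    2 * √2 * orbitPeriod p r = ∫ θ in (0 : ℝ)..2 * Real.pi, wellSym p (r * |Real.sin θ|) := by
  have hc := continuous_orbitSpeed hp hr
  have hneg : ∀ θ, orbitSpeed p r (θ + Real.pi) = wellG' p (-(r * Real.sin θ)) / √2 := by
    intro θ
    rw [orbitSpeed, Real.sin_add_pi, mul_neg]
  have h1 : orbitPeriod p r = ∫ θ in (0 : ℝ)..2 * Real.pi, orbitSpeed p r (θ + Real.pi) := by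
    rw [intervalIntegral.integral_comp_add_right, zero_add, add_comm,
      periodic_orbitSpeed.intervalIntegral_add_eq Real.pi 0, zero_add]
    rfl
  have h2 : 2 * √2 * orbitPeriod p r =
      √2 * (orbitPeriod p r + ∫ θ in (0 : ℝ)..2 * Real.pi, orbitSpeed p r (θ + Real.pi)) := by
    rw [← h1]
    ring
  have hc' : Continuous fun θ => orbitSpeed p r (θ + Real.pi) :=
    hc.comp (continuous_add_const Real.pi)
  rw [h2, orbitPeriod, orbitTime, ← intervalIntegral.integral_add (hc.intervalIntegrable _ _)
    (hc'.intervalIntegrable _ _),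
    ← intervalIntegral.integral_const_mul]
  refine intervalIntegral.integral_congr fun θ _ => ?_
  have e : wellSym p (r * |Real.sin θ|) = wellSym p (r * Real.sin θ) := by
    rcases abs_choice (Real.sin θ) with h | h <;> rw [h]
    rw [mul_neg, wellSym_neg]
  have h2 : (√2 : ℝ) ≠ 0 := by positivity
  change √2 * (orbitSpeed p r θ + orbitSpeed p r (θ + Real.pi)) = wellSym p (r * |Real.sin θ|)
  rw [e, hneg, wellSym, orbitSpeed]
  field_simp

lemma continuous_wellSym_mul_abs_sin (hp : 0 < p) (hr : r ∈ Ioo (-wellRho p) (wellRho p)) :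
    Continuous fun θ => wellSym p (r * |Real.sin θ|) := by
  rw [continuous_iff_continuousAt]
  intro θ
  have h1 : |(r * |Real.sin θ|)| < wellRho p := by
    rw [abs_mul, abs_abs]
    exact (mul_le_of_le_one_right (abs_nonneg _) (Real.abs_sin_le_one _)).trans_lt (abs_lt.2 hr)
  have h2 := abs_lt.1 h1
  have hc : ContinuousAt (wellSym p) (r * |Real.sin θ|) :=
    (continuousAt_wellG' hp h2.1).add
      (ContinuousAt.comp (f := fun s : ℝ => -s) (continuousAt_wellG' hp (by linarith))
        continuousAt_neg)
  exact ContinuousAt.comp (f := fun θ => r * |Real.sin θ|) hc (by fun_prop)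

/-- The period is a strictly increasing function of the amplitude. -/
theorem strictMonoOn_orbitPeriod (hp : 0 < p) :
    StrictMonoOn (orbitPeriod p) (Ico 0 (wellRho p)) := by
  intro r hr r' hr' hlt
  have hρ := wellRho_pos hp
  have h1 : r ∈ Ioo (-wellRho p) (wellRho p) := ⟨by linarith [hr.1], hr.2⟩
  have h1' : r' ∈ Ioo (-wellRho p) (wellRho p) := ⟨by linarith [hr'.1], hr'.2⟩
  have key : 2 * √2 * orbitPeriod p r < 2 * √2 * orbitPeriod p r' := by
    rw [orbitPeriod_eq_integral_wellSym hp h1, orbitPeriod_eq_integral_wellSym hp h1']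
    have hmem : ∀ r ∈ Ico 0 (wellRho p), ∀ θ, r * |Real.sin θ| ∈ Ico 0 (wellRho p) := by
      intro r hr θ
      exact ⟨mul_nonneg hr.1 (abs_nonneg _),
        (mul_le_of_le_one_right hr.1 (Real.abs_sin_le_one _)).trans_lt hr.2⟩
    refine intervalIntegral.integral_lt_integral_of_continuousOn_of_le_of_exists_lt
      Real.two_pi_pos (continuous_wellSym_mul_abs_sin hp h1).continuousOn
      (continuous_wellSym_mul_abs_sin hp h1').continuousOn (fun θ _ => ?_)
      ⟨Real.pi / 2, ⟨by positivity, by linarith [Real.pi_pos]⟩, ?_⟩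
    · refine (strictMonoOn_wellSym hp).monotoneOn (hmem r hr θ) (hmem r' hr' θ) ?_
      gcongr
    · rw [Real.sin_pi_div_two, abs_one, mul_one, mul_one]
      exact strictMonoOn_wellSym hp hr hr' hlt
  exact lt_of_mul_lt_mul_left key (by positivity)

/-- The quarter turn descending from y = 1 to the minimum already takes this long. With ε² + r² = ρ²
the radicand ρ² - r² sin² θ equals ε² + r² cos² θ ≤ (ε + r cos θ)², which turns the lower bound for
g' into the derivative of a logarithm. -/
lemma log_le_orbitPeriod (hp : 0 < p) {ε : ℝ} (hε : 0 < ε) (hr : 0 < r)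
    (hrε : ε ^ 2 + r ^ 2 = wellRho p ^ 2) :
    √2 * wellRho p * Real.log ((ε + r) / ε) ≤ orbitPeriod p r := by
  have hρ := wellRho_pos hp
  have hrρ : r < wellRho p := lt_of_pow_lt_pow_left₀ 2 hρ.le (by nlinarith [sq_pos_of_pos hε])
  have hmem : r ∈ Ioo (-wellRho p) (wellRho p) := ⟨by linarith, hrρ⟩
  have hc := continuous_orbitSpeed hp hmem
  have hpi := Real.pi_pos
  -- the explicit lower bound is integrated with its primitive
  set F : ℝ → ℝ := fun θ => √2 * wellRho p * -Real.log (ε + r * Real.cos θ) with hF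
  have hpos : ∀ θ ∈ Icc 0 (Real.pi / 2), 0 < ε + r * Real.cos θ := by
    intro θ hθ
    have := Real.cos_nonneg_of_mem_Icc (x := θ) ⟨by linarith [hθ.1], hθ.2⟩
    positivity
  have hFd : ∀ θ ∈ Icc 0 (Real.pi / 2), HasDerivAt F
      (√2 * wellRho p * (r * Real.sin θ / (ε + r * Real.cos θ))) θ := by
    intro θ hθ
    have h := (((((Real.hasDerivAt_cos θ).const_mul r).const_add ε).log
      (hpos θ hθ).ne').neg).const_mul (√2 * wellRho p)
    exact h.congr_deriv (by ring)
  have hle : F (Real.pi / 2) - F 0 ≤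
      ∫ θ in (0 : ℝ)..Real.pi / 2, orbitSpeed p r (θ + Real.pi) := by
    refine intervalIntegral.sub_le_integral_of_hasDeriv_right_of_le (by positivity)
      (fun θ hθ => (hFd θ hθ).continuousAt.continuousWithinAt)
      (fun θ hθ => (hFd θ ⟨hθ.1.le, hθ.2.le⟩).hasDerivWithinAt)
      ((hc.comp (continuous_add_const Real.pi)).continuousOn.integrableOn_Icc) ?_
    intro θ hθ
    have hs0 : 0 < Real.sin θ := Real.sin_pos_of_pos_of_lt_pi hθ.1 (by linarith [hθ.2])
    have hc0 : 0 < Real.cos θ := Real.cos_pos_of_mem_Ioo ⟨by linarith [hθ.1], hθ.2⟩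
    have hs1 := Real.sin_le_one θ
    have hsc := Real.sin_sq_add_cos_sq θ
    have h1 := le_wellG'_neg hp (s := r * Real.sin θ) (by positivity) (by nlinarith)
    have hrad : √(wellRho p ^ 2 - (r * Real.sin θ) ^ 2) ≤ ε + r * Real.cos θ := by
      refine Real.sqrt_le_iff.2 ⟨by positivity, ?_⟩
      have : wellRho p ^ 2 - (r * Real.sin θ) ^ 2 = ε ^ 2 + (r * Real.cos θ) ^ 2 := by
        rw [← hrε]
        linear_combination -r ^ 2 * hsc
      rw [this]
      have : 0 < ε * (r * Real.cos θ) := by positivity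
      nlinarith
    have hrad0 : 0 < √(wellRho p ^ 2 - (r * Real.sin θ) ^ 2) := by
      refine Real.sqrt_pos.2 ?_
      have : wellRho p ^ 2 - (r * Real.sin θ) ^ 2 = ε ^ 2 + (r * Real.cos θ) ^ 2 := by
        rw [← hrε]
        linear_combination -r ^ 2 * hsc
      rw [this]
      positivity
    rw [orbitSpeed, Real.sin_add_pi, mul_neg]
    have h2 : (0 : ℝ) < √2 := by positivity
    have hsq : (√2 : ℝ) ^ 2 = 2 := Real.sq_sqrt (by norm_num)
    rw [le_div_iff₀ h2]
    refine le_trans ?_ h1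
    calc √2 * wellRho p * (r * Real.sin θ / (ε + r * Real.cos θ)) * √2
        = √2 ^ 2 * wellRho p * (r * Real.sin θ) / (ε + r * Real.cos θ) := by ring
      _ = 2 * wellRho p * (r * Real.sin θ) / (ε + r * Real.cos θ) := by rw [hsq]
      _ ≤ _ := by gcongr
  have hval : F (Real.pi / 2) - F 0 = √2 * wellRho p * Real.log ((ε + r) / ε) := by
    simp only [hF, Real.cos_pi_div_two, Real.cos_zero, mul_zero, add_zero, mul_one]
    rw [Real.log_div (by positivity) hε.ne']
    ring
  rw [← hval]
  refine hle.trans ?_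
  rw [intervalIntegral.integral_comp_add_right (fun θ => orbitSpeed p r θ), zero_add]
  refine intervalIntegral.integral_mono_interval (by positivity) (by linarith) (by linarith) ?_
    (hc.intervalIntegrable _ _)
  exact Eventually.of_forall fun θ => (orbitSpeed_pos hp hmem θ).le

lemma exists_lt_orbitPeriod (hp : 0 < p) (L : ℝ) :
    ∃ r ∈ Ioo 0 (wellRho p), L ≤ orbitPeriod p r := by
  have hρ := wellRho_pos hp
  -- K is chosen with √2 ρ K ≥ |L|. With δ = e^(-K), r = ρ√(1-δ²) and ε = ρδ, the logarithm is at
  -- least log(1/δ) = K because δ + √(1-δ²) ≥ 1.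
  set K := |L| / (√2 * wellRho p) + 1 with hK
  have hK0 : 0 < K := by positivity
  set δ := Real.exp (-K) with hδ
  have hδ0 : 0 < δ := Real.exp_pos _
  have hδ1 : δ < 1 := Real.exp_zero ▸ Real.exp_lt_exp.2 (by linarith)
  have h1 : 0 < 1 - δ ^ 2 := by nlinarith
  set c := √(1 - δ ^ 2) with hc
  have hc0 : 0 < c := Real.sqrt_pos.2 h1
  have hc2 : c ^ 2 = 1 - δ ^ 2 := Real.sq_sqrt h1.le
  have hc1 : c < 1 := by nlinarith
  have hsum : 1 ≤ δ + c := by nlinarith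
  refine ⟨wellRho p * c, ⟨by positivity, by nlinarith⟩, ?_⟩
  have h := log_le_orbitPeriod hp (ε := wellRho p * δ) (r := wellRho p * c) (by positivity)
    (by positivity) (by rw [mul_pow, mul_pow, hc2]; ring)
  refine le_trans ?_ h
  have hlog : K ≤ Real.log ((wellRho p * δ + wellRho p * c) / (wellRho p * δ)) := by
    rw [Real.le_log_iff_exp_le (by positivity), le_div_iff₀ (by positivity), hδ]
    have : Real.exp K * Real.exp (-K) = 1 := by rw [← Real.exp_add]; simp
    calc Real.exp K * (wellRho p * Real.exp (-K)) = wellRho p * (Real.exp K * Real.exp (-K)) := by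
          ring
      _ = wellRho p * 1 := by rw [this]
      _ ≤ wellRho p * (δ + c) := by gcongr
      _ = _ := by rw [hδ]; ring
  have h3 : |L| ≤ √2 * wellRho p * K := by
    rw [hK, mul_add, mul_div_cancel₀ _ (by positivity)]
    have : 0 < √2 * wellRho p * 1 := by positivity
    linarith
  calc L ≤ |L| := le_abs_self L
    _ ≤ √2 * wellRho p * K := h3
    _ ≤ _ := by gcongr

lemma exists_orbitPeriod_eq (hp : 0 < p) {L : ℝ} (hL : 2 * Real.pi / √p < L) :
    ∃ r ∈ Ioo 0 (wellRho p), orbitPeriod p r = L := by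
  obtain ⟨R, hR, hLR⟩ := exists_lt_orbitPeriod hp L
  have hρ := wellRho_pos hp
  have hcont : ContinuousOn (orbitPeriod p) (Icc 0 R) :=
    (continuousOn_orbitPeriod hp).mono fun x hx => ⟨by linarith [hx.1], hx.2.trans_lt hR.2⟩
  rw [← orbitPeriod_zero hp] at hL
  obtain ⟨r, hr, hrL⟩ := intermediate_value_Icc hR.1.le hcont ⟨hL.le, hLR⟩
  refine ⟨r, ⟨lt_of_le_of_ne hr.1 ?_, hr.2.trans_lt hR.2⟩, hrL⟩
  -- The intermediate value could only be taken at r = 0 if L were the linearised period, which the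
  -- strict inequality rules out.
  rintro rfl
  exact hL.ne hrL

end Period

/-! ### Classification of the solutions up to translation. -/

section Classification

variable {q T : ℝ} {y z : ℝ → ℝ}

namespace IsPosPeriodicSolution

lemma differentiable (h : IsPosPeriodicSolution q T y) : Differentiable ℝ y :=
  h.contDiff.differentiable (by norm_num)

lemma hasDerivAt_deriv (h : IsPosPeriodicSolution q T y) (t : ℝ) :
    HasDerivAt (deriv y) (-wellV' (q - 2) (y t)) t := by
  have h1 : ContDiff ℝ (1 + 1) y := h.contDiff
  rw [contDiff_succ_iff_deriv] at h1
  have h2 := (h1.2.2.differentiable one_ne_zero t).hasDerivAt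
  refine h2.congr_deriv ?_
  have := h.equation t
  rw [wellV'_eq (h.pos t), show q - 2 + 1 = q - 1 by ring]
  linarith

lemma comp_add_const (h : IsPosPeriodicSolution q T y) (c : ℝ) :
    IsPosPeriodicSolution q T fun x => y (x + c) := by
  have e : deriv (fun x => y (x + c)) = fun x => deriv y (x + c) :=
    funext fun x => deriv_comp_add_const y c x
  refine ⟨h.contDiff.comp (contDiff_id.add contDiff_const), fun x => h.pos _, fun x => ?_,
    fun x => ?_⟩
  · rw [add_right_comm]
    exact h.periodic _
  · rw [e, deriv_comp_add_const]
    exact h.equation _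

/-- The range of a positive periodic solution is contained in a compact subinterval of
`(0, ∞)` whose end points are attained. -/
lemma exists_min_max (h : IsPosPeriodicSolution q T y) (hT : 0 < T) :
    ∃ t₁ t₂, ∀ t, y t₁ ≤ y t ∧ y t ≤ y t₂ := by
  have hc : Continuous y := h.differentiable.continuous
  have hK : IsCompact (Icc 0 (2 * T)) := isCompact_Icc
  have hne : (Icc 0 (2 * T)).Nonempty := ⟨0, le_rfl, by linarith⟩
  obtain ⟨t₁, -, h1⟩ := hK.exists_isMinOn hne hc.continuousOn
  obtain ⟨t₂, -, h2⟩ := hK.exists_isMaxOn hne hc.continuousOn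
  refine ⟨t₁, t₂, fun t => ?_⟩
  obtain ⟨s, hs, hst⟩ := h.periodic.exists_mem_Ico₀ (by linarith : 0 < 2 * T) t
  rw [hst]
  exact ⟨h1 ⟨hs.1, hs.2.le⟩, h2 ⟨hs.1, hs.2.le⟩⟩

/-- Conservation of energy. -/
lemma energy_eq (hq : 2 < q) (h : IsPosPeriodicSolution q T y) (s t : ℝ) :
    deriv y s ^ 2 / 2 + wellV (q - 2) (y s) = deriv y t ^ 2 / 2 + wellV (q - 2) (y t) := by
  have hp : 0 < q - 2 := sub_pos.2 hq
  have hd : ∀ t, HasDerivAt (fun t => deriv y t ^ 2 / 2 + wellV (q - 2) (y t)) 0 t := by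
    intro t
    have h1 := (((h.hasDerivAt_deriv t).pow 2).div_const 2).add
      ((hasDerivAt_wellV hp (h.pos t)).comp t (h.differentiable t).hasDerivAt)
    refine h1.congr_deriv ?_
    push_cast
    ring
  exact is_const_of_deriv_eq_zero (fun t => (hd t).differentiableAt) (fun t => (hd t).deriv) s t

/-- Solutions are determined by their initial data. -/
lemma eq_of_initial (hT : 0 < T) {T' : ℝ} (hT' : 0 < T')
    (hy : IsPosPeriodicSolution q T y) (hz : IsPosPeriodicSolution q T' z) {t₀ : ℝ}
    (h0 : y t₀ = z t₀) (h1 : deriv y t₀ = deriv z t₀) : y = z := by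
  obtain ⟨a, b, hab⟩ := hy.exists_min_max hT
  obtain ⟨c, d, hcd⟩ := hz.exists_min_max hT'
  -- The vector field need not be globally Lipschitz, but both solutions stay in the compact
  -- interval [m, M] inside (0, ∞), on which V'' is bounded. The two half-periods are independent
  -- because a model orbit brings its own.
  set m := min (y a) (z c) with hm
  set M := max (y b) (z d) with hM
  have hm0 : 0 < m := lt_min (hy.pos a) (hz.pos c)
  have hc2 : ContinuousOn (fun u => ‖-wellV'' (q - 2) u‖) (Icc m M) := fun u hu =>
    (hasDerivAt_wellV'' (hm0.trans_le hu.1)).continuousAt.neg.norm.continuousWithinAt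
  obtain ⟨C, hC⟩ := isCompact_Icc.bddAbove_image hc2
  have hlip : LipschitzOnWith C.toNNReal (fun u => -wellV' (q - 2) u) (Icc m M) := by
    refine (convex_Icc m M).lipschitzOnWith_of_nnnorm_hasDerivWithin_le
      (f' := fun u => -wellV'' (q - 2) u)
      (fun u hu => (hasDerivAt_wellV' (hm0.trans_le hu.1)).neg.hasDerivWithinAt) fun u hu => ?_
    have := hC (mem_image_of_mem _ hu)
    rw [← NNReal.coe_le_coe, coe_nnnorm]
    exact this.trans (Real.le_coe_toNNReal C)
  have hv : ∀ _ : ℝ, LipschitzOnWith (max 1 (C.toNNReal * 1))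
      (fun x : ℝ × ℝ => (x.2, -wellV' (q - 2) x.1)) (Prod.fst ⁻¹' Icc m M) := by
    intro _
    refine LipschitzOnWith.prodMk LipschitzWith.prod_snd.lipschitzOnWith ?_
    exact hlip.comp LipschitzWith.prod_fst.lipschitzOnWith fun x hx => hx
  have key := ODE_solution_unique_univ (t₀ := t₀) (s := fun _ => Prod.fst ⁻¹' Icc m M) hv
    (f := fun t => (y t, deriv y t)) (g := fun t => (z t, deriv z t))
    (fun t => ⟨(hy.differentiable t).hasDerivAt.prodMk (hy.hasDerivAt_deriv t),
      (min_le_left _ _).trans (hab t).1, (hab t).2.trans (le_max_left _ _)⟩)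
    (fun t => ⟨(hz.differentiable t).hasDerivAt.prodMk (hz.hasDerivAt_deriv t),
      (min_le_right _ _).trans (hcd t).1, (hcd t).2.trans (le_max_right _ _)⟩)
    (Prod.ext h0 h1)
  exact funext fun t => congrArg Prod.fst (congrFun key t)

/-- A constant positive solution is identically `1`. -/
lemma eq_one_of_const (hq : 2 < q) (h : IsPosPeriodicSolution q T y) {c : ℝ}
    (hc : ∀ x, y x = c) (x : ℝ) : y x = 1 := by
  by_contra hne
  have hp : 0 < q - 2 := sub_pos.2 hq
  have e : y = fun _ => c := funext hc
  have h1 := h.hasDerivAt_deriv x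
  have h2 : deriv y = fun _ => 0 := by
    rw [e]
    exact funext fun _ => deriv_const _ _
  rw [h2] at h1
  have h3 := h1.unique (hasDerivAt_const x (0 : ℝ))
  exact wellV'_ne_zero hp (h.pos x) hne (neg_eq_zero.1 h3)

/-- Every non-constant positive periodic solution is a translate of one of the model orbits. -/
lemma eq_orbit (hq : 2 < q) (hT : 0 < T) (h : IsPosPeriodicSolution q T y)
    (hne : ¬∃ c, ∀ x, y x = c) :
    ∃ r ∈ Ioo 0 (wellRho (q - 2)), ∃ c, ∀ x, y x = orbit (q - 2) r (x + c) := by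
  have hp : 0 < q - 2 := sub_pos.2 hq
  obtain ⟨t₁, t₂, ht⟩ := h.exists_min_max hT
  have hd1 : deriv y t₁ = 0 :=
    IsLocalMin.deriv_eq_zero (Eventually.of_forall fun t => (ht t).1)
  have hd2 : deriv y t₂ = 0 :=
    IsLocalMax.deriv_eq_zero (Eventually.of_forall fun t => (ht t).2)
  have hE := h.energy_eq hq t₁ t₂
  rw [hd1, hd2] at hE
  have hV : wellV (q - 2) (y t₁) = wellV (q - 2) (y t₂) := by linarith
  have hlt : y t₁ < y t₂ := by
    refine lt_of_le_of_ne (ht t₂).1 fun he => hne ⟨y t₁, fun x => ?_⟩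
    exact le_antisymm (he ▸ (ht x).2) (ht x).1
  -- Distinct points with equal potential lie on opposite sides of 1, since V is strictly monotone
  -- on each side.
  have h1 : y t₁ < 1 := by
    by_contra! hge
    exact (strictMonoOn_wellV hp hge (hge.trans hlt.le) hlt).ne hV
  have h2 : 1 < y t₂ := by
    by_contra! hle
    exact (strictAntiOn_wellV hp ⟨(h.pos t₁).le, h1.le⟩ ⟨(h.pos t₂).le, hle⟩ hlt).ne' hV
  set r := wellH (q - 2) (y t₂) with hr
  have hr0 : 0 < r := by
    rw [← wellH_one hp]
    exact strictMono_wellH hp h2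
  have hrsq : r ^ 2 = wellV (q - 2) (y t₁) := by rw [hr, wellH_sq hp (h.pos _).le, hV]
  -- The amplitude is read off at the maximum but bounded at the minimum: there 0 < y < 1, so V(y) <
  -- V(0) = ρ².
  have hrρ : r < wellRho (q - 2) := by
    refine lt_of_pow_lt_pow_left₀ 2 (wellRho_pos hp).le ?_
    rw [hrsq, wellRho_sq hp]
    exact strictAntiOn_wellV hp ⟨le_rfl, zero_le_one⟩ ⟨(h.pos t₁).le, h1.le⟩ (h.pos t₁)
  have hr' : r ∈ Ioo (-wellRho (q - 2)) (wellRho (q - 2)) := ⟨by linarith, hrρ⟩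
  have hP := orbitPeriod_pos hp hr'
  set s := orbitTime (q - 2) r (Real.pi / 2) with hs
  have horb : IsPosPeriodicSolution q (orbitPeriod (q - 2) r / 2) (orbit (q - 2) r) := by
    refine orbit_isPosPeriodicSolution hq hr' ?_
    rw [mul_div_cancel₀ _ (two_ne_zero' ℝ)]
    exact periodic_orbit hp hr'
  refine ⟨r, ⟨hr0, hrρ⟩, s - t₂, fun x => ?_⟩
  refine congrFun (eq_of_initial hT (half_pos hP) h (horb.comp_add_const (s - t₂))
    (t₀ := t₂) ?_ ?_) x
  · rw [add_sub_cancel, orbit_at_max hp hr', hr, wellG_wellH hp]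
  · rw [deriv_comp_add_const, add_sub_cancel, deriv_orbit_at_max hp hr', hd2]

end IsPosPeriodicSolution

lemma isPosPeriodicSolution_one (q T : ℝ) : IsPosPeriodicSolution q T fun _ => 1 :=
  ⟨contDiff_const, fun _ => one_pos, fun _ => rfl, fun x => by simp⟩

lemma HasMinimalPeriod.comp_add_const {p : ℝ} (h : HasMinimalPeriod y p) (c : ℝ) :
    HasMinimalPeriod (fun x => y (x + c)) p := by
  have e : {s : ℝ | 0 < s ∧ Function.Periodic (fun x => y (x + c)) s} =
      {s : ℝ | 0 < s ∧ Function.Periodic y s} := by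
    ext s
    refine and_congr_right fun _ => ⟨fun hs x => ?_, fun hs x => ?_⟩
    · have := hs (x - c)
      simpa only [add_right_comm _ s c, sub_add_cancel] using this
    · simp only [add_right_comm _ s c]
      exact hs _
  rw [HasMinimalPeriod, e]
  exact h

lemma HasMinimalPeriod.of_isTranslate {p : ℝ} (h : HasMinimalPeriod y p) (hyz : IsTranslate y z) :
    HasMinimalPeriod z p := by
  obtain ⟨c, hc⟩ := hyz
  rw [show z = fun x => y (x + c) from funext hc]
  exact h.comp_add_const c

lemma HasMinimalPeriod.not_const {p : ℝ} (h : HasMinimalPeriod y p) : ¬∃ c, ∀ x, y x = c := by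
  rintro ⟨c, hc⟩
  have h1 := h.2 (show p / 2 ∈ _ from ⟨half_pos h.1.1, fun x => by rw [hc, hc]⟩)
  linarith [h.1.1]

/-- Every period is a multiple of the minimal one. -/
lemma HasMinimalPeriod.exists_nat_mul {p s : ℝ} (h : HasMinimalPeriod y p) (hs : 0 < s)
    (hper : Function.Periodic y s) : ∃ n : ℕ, 1 ≤ n ∧ s = n * p := by
  have hp : 0 < p := h.1.1
  set n := ⌊s / p⌋₊ with hn
  have h1 : n * p ≤ s := (le_div_iff₀ hp).1 (Nat.floor_le (by positivity))
  have h2 : s < (n + 1) * p := (div_lt_iff₀ hp).1 (Nat.lt_floor_add_one _)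
  have h3 : s = n * p := by
    by_contra hne
    have h4 := h.2 (show s - n * p ∈ _ from
      ⟨sub_pos.2 (lt_of_le_of_ne h1 (Ne.symm hne)), hper.sub_period (h.1.2.nat_mul n)⟩)
    linarith
  refine ⟨n, ?_, h3⟩
  by_contra! h0
  have : n = 0 := by omega
  rw [this] at h3
  simp at h3
  linarith

lemma IsTranslate.symm (h : IsTranslate y z) : IsTranslate z y := by
  obtain ⟨c, hc⟩ := h
  exact ⟨-c, fun x => by rw [hc, neg_add_cancel_right]⟩

lemma IsTranslate.trans {w : ℝ → ℝ} (h : IsTranslate y z) (h' : IsTranslate z w) :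
    IsTranslate y w := by
  obtain ⟨c, hc⟩ := h
  obtain ⟨d, hd⟩ := h'
  exact ⟨d + c, fun x => by rw [hd, hc, add_assoc]⟩

/-- A non-constant solution is a translate of an orbit with a minimal period above the linearised
one. -/
lemma IsPosPeriodicSolution.exists_orbit (hq : 2 < q) (hT : 0 < T)
    (h : IsPosPeriodicSolution q T y) (hne : ¬∃ c, ∀ x, y x = c) :
    ∃ r ∈ Ioo 0 (wellRho (q - 2)), IsTranslate (orbit (q - 2) r) y ∧
      HasMinimalPeriod y (orbitPeriod (q - 2) r) ∧
      2 * Real.pi / √(q - 2) < orbitPeriod (q - 2) r := by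
  have hp : 0 < q - 2 := sub_pos.2 hq
  obtain ⟨r, hr, hc⟩ := h.eq_orbit hq hT hne
  refine ⟨r, hr, hc, (hasMinimalPeriod_orbit hp hr).of_isTranslate hc, ?_⟩
  rw [← orbitPeriod_zero hp]
  exact strictMonoOn_orbitPeriod hp ⟨le_rfl, wellRho_pos hp⟩ ⟨hr.1.le, hr.2⟩ hr.1

lemma HasMinimalPeriod.unique {p p' : ℝ} (h : HasMinimalPeriod y p) (h' : HasMinimalPeriod y p') :
    p = p' := IsLeast.unique h h'

/-- Equal minimal periods mean equal amplitudes, by injectivity of the period function, so both are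
translates of the same model orbit. -/
lemma isTranslate_of_hasMinimalPeriod (hq : 2 < q) (hT : 0 < T) {L : ℝ}
    (hy : IsPosPeriodicSolution q T y) (hyL : HasMinimalPeriod y L)
    (hz : IsPosPeriodicSolution q T z) (hzL : HasMinimalPeriod z L) : IsTranslate y z := by
  have hp : 0 < q - 2 := sub_pos.2 hq
  obtain ⟨r, hr, hry, hrL, -⟩ := hy.exists_orbit hq hT hyL.not_const
  obtain ⟨r', hr', hrz, hrL', -⟩ := hz.exists_orbit hq hT hzL.not_const
  have e : r = r' := (strictMonoOn_orbitPeriod hp).injOn ⟨hr.1.le, hr.2⟩ ⟨hr'.1.le, hr'.2⟩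
    ((hrL.unique hyL).trans (hzL.unique hrL'))
  subst e
  exact hry.symm.trans hrz

lemma exists_hasMinimalPeriod (hq : 2 < q) {n : ℕ} (hn : 1 ≤ n)
    (hL : 2 * Real.pi / √(q - 2) < 2 * T / n) :
    ∃ y, IsPosPeriodicSolution q T y ∧ HasMinimalPeriod y (2 * T / n) := by
  have hp : 0 < q - 2 := sub_pos.2 hq
  obtain ⟨r, hr, hrL⟩ := exists_orbitPeriod_eq hp hL
  have hr' : r ∈ Ioo (-wellRho (q - 2)) (wellRho (q - 2)) :=
    ⟨by linarith [hr.1, wellRho_pos hp], hr.2⟩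
  refine ⟨orbit (q - 2) r, orbit_isPosPeriodicSolution hq hr' ?_,
    hrL ▸ hasMinimalPeriod_orbit hp hr⟩
  have h := (periodic_orbit hp hr').nat_mul n
  have hn0 : (n : ℝ) ≠ 0 := by positivity
  rwa [hrL, mul_div_cancel₀ _ hn0] at h

end Classification

/-! ### Counting the classes. -/

theorem theorem3 (k : ℕ) (hk : 1 ≤ k) (T q : ℝ) (hT : 0 < T)
    (hq₁ : (((k : ℝ) - 1) * Real.pi / T) ^ 2 + 2 < q)
    (hq₂ : q ≤ ((k : ℝ) * Real.pi / T) ^ 2 + 2) :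
    -- there are exactly `k` classes of solutions up to translation
    Nat.card (Quotient (translateSetoid q T)) = k ∧
    -- the constant function `1` is a solution
    IsPosPeriodicSolution q T (fun _ => 1) ∧
    -- for each `n = 1, …, k - 1` there is, up to translation, exactly one solution
    -- with minimal period `2T / n`, and it is not constant
    (∀ n : ℕ, 1 ≤ n → n + 1 ≤ k →
      (∃ y : ℝ → ℝ, IsPosPeriodicSolution q T y ∧ (¬ ∃ c : ℝ, ∀ x, y x = c) ∧
        HasMinimalPeriod y (2 * T / n)) ∧
      (∀ y z : ℝ → ℝ, IsPosPeriodicSolution q T y → HasMinimalPeriod y (2 * T / n) →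
        IsPosPeriodicSolution q T z → HasMinimalPeriod z (2 * T / n) → IsTranslate y z)) ∧
    -- there are no other solutions
    (∀ y : ℝ → ℝ, IsPosPeriodicSolution q T y →
      (∀ x, y x = 1) ∨
        ∃ n : ℕ, 1 ≤ n ∧ n + 1 ≤ k ∧ HasMinimalPeriod y (2 * T / n)) := by
  have hq : 2 < q := lt_of_le_of_lt (le_add_of_nonneg_left (sq_nonneg _)) hq₁
  have hp : 0 < q - 2 := sub_pos.2 hq
  have hpi := Real.pi_pos
  have hs : 0 < √(q - 2) := Real.sqrt_pos.2 hp
  have hk1 : (1 : ℝ) ≤ k := by exact_mod_cast hk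
  -- The hypotheses on q amount to k - 1 < T√(q-2)/π ≤ k.
  have hlow : ((k : ℝ) - 1) * Real.pi / T < √(q - 2) :=
    Real.lt_sqrt_of_sq_lt (by linarith)
  have hupp : √(q - 2) ≤ (k : ℝ) * Real.pi / T :=
    Real.sqrt_le_iff.2 ⟨by positivity, by linarith⟩
  rw [div_lt_iff₀ hT] at hlow
  rw [le_div_iff₀ hT] at hupp
  have hex : ∀ n : ℕ, 1 ≤ n → n + 1 ≤ k →
      ∃ y, IsPosPeriodicSolution q T y ∧ HasMinimalPeriod y (2 * T / n) := by
    intro n hn hnk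
    refine exists_hasMinimalPeriod hq hn ?_
    have hn0 : (0 : ℝ) < n := by positivity
    have hnk' : (n : ℝ) + 1 ≤ k := by exact_mod_cast hnk
    rw [div_lt_div_iff₀ hs hn0]
    nlinarith
  have hclass : ∀ y, IsPosPeriodicSolution q T y → (∀ x, y x = 1) ∨
      ∃ n : ℕ, 1 ≤ n ∧ n + 1 ≤ k ∧ HasMinimalPeriod y (2 * T / n) := by
    intro y hy
    by_cases hc : ∃ c, ∀ x, y x = c
    · obtain ⟨c, hc⟩ := hc
      exact Or.inl (hy.eq_one_of_const hq hc)
    · obtain ⟨r, -, -, hmin, hlt⟩ := hy.exists_orbit hq hT hc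
      obtain ⟨n, hn, hnT⟩ := hmin.exists_nat_mul (by positivity) hy.periodic
      have hn0 : (0 : ℝ) < n := by positivity
      have e : orbitPeriod (q - 2) r = 2 * T / n := by
        rw [hnT, mul_div_cancel_left₀ _ hn0.ne']
      rw [e] at hmin hlt
      refine Or.inr ⟨n, hn, ?_, hmin⟩
      rw [div_lt_div_iff₀ hs hn0] at hlt
      -- nπ < T√(q-2) ≤ kπ. The first inequality is strict because P exceeds its value at r = 0, and
      -- this excludes n = k even when q is the upper end point.
      have : (n : ℝ) < k := by
        by_contra! hge
        nlinarith
      exact_mod_cast this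
  have huniq : ∀ (L : ℝ) (y z : ℝ → ℝ), IsPosPeriodicSolution q T y → HasMinimalPeriod y L →
      IsPosPeriodicSolution q T z → HasMinimalPeriod z L → IsTranslate y z :=
    fun L y z hy hyL hz hzL => isTranslate_of_hasMinimalPeriod hq hT hy hyL hz hzL
  refine ⟨?_, isPosPeriodicSolution_one q T, fun n hn hnk => ⟨?_, huniq _⟩, hclass⟩
  -- Index 0 stands for the constant solution and index n ≥ 1 for minimal period 2T/n, which gives 1
  -- + (k - 1) classes.
  · have hfam : ∀ i : Fin k, ∃ y, IsPosPeriodicSolution q T y ∧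
        (i.1 = 0 → y = fun _ => 1) ∧ (i.1 ≠ 0 → HasMinimalPeriod y (2 * T / (i.1 : ℕ))) := by
      intro i
      by_cases hi : i.1 = 0
      · exact ⟨_, isPosPeriodicSolution_one q T, fun _ => rfl, fun h => absurd hi h⟩
      · obtain ⟨y, hy, hyL⟩ := hex i.1 (Nat.one_le_iff_ne_zero.2 hi) i.2
        exact ⟨y, hy, fun h => absurd h hi, fun _ => hyL⟩
    choose Y hY hY0 hYn using hfam
    let F : Fin k → Quotient (translateSetoid q T) := fun i => Quotient.mk _ ⟨Y i, hY i⟩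
    have hconst : ∀ i j : Fin k, IsTranslate (Y i) (Y j) → i.1 = 0 → j.1 = 0 := by
      intro i j ⟨c, hc⟩ hi
      by_contra hj
      refine (hYn j hj).not_const ⟨1, fun x => ?_⟩
      rw [hc, hY0 i hi]
    have hinj : Function.Injective F := by
      intro i j hij
      have hT' : IsTranslate (Y i) (Y j) := Quotient.exact hij
      by_cases hi : i.1 = 0
      · exact Fin.ext (hi.trans (hconst i j hT' hi).symm)
      · have hj : j.1 ≠ 0 := fun hj => hi (hconst j i hT'.symm hj)
        have h := ((hYn i hi).of_isTranslate hT').unique (hYn j hj)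
        have hi0 : (0 : ℝ) < i.1 := by exact_mod_cast Nat.pos_of_ne_zero hi
        have hj0 : (0 : ℝ) < j.1 := by exact_mod_cast Nat.pos_of_ne_zero hj
        rw [div_eq_div_iff hi0.ne' hj0.ne'] at h
        have h' := mul_left_cancel₀ (by positivity : (2 * T : ℝ) ≠ 0) h
        exact Fin.ext (by exact_mod_cast h'.symm)
    have hsurj : Function.Surjective F := by
      intro x
      induction x using Quotient.inductionOn with
      | h y =>
        obtain ⟨y, hy⟩ := y
        rcases hclass y hy with h1 | ⟨n, hn, hnk, hL⟩
        · refine ⟨⟨0, hk⟩, Quotient.sound ⟨0, fun x => ?_⟩⟩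
          change y x = Y ⟨0, hk⟩ (x + 0)
          rw [h1, hY0 ⟨0, hk⟩ rfl]
        · exact ⟨⟨n, hnk⟩, Quotient.sound (huniq _ _ _ (hY _)
            (hYn ⟨n, hnk⟩ (Nat.one_le_iff_ne_zero.1 hn)) hy hL)⟩
    rw [← Nat.card_eq_of_bijective F ⟨hinj, hsurj⟩, Nat.card_eq_fintype_card, Fintype.card_fin]
  · obtain ⟨y, hy, hyL⟩ := hex n hn hnk
    exact ⟨y, hy, hyL.not_const, hyL⟩
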